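/- Fix integers $r\ge 0$, $m\ge 1$, $s\ge 1$. For $n\ge 0$ consider set partitions of $[r+n]=\{1,\dots,r+n\}$ in which $1,\dots,r$ lie in different blocks; the blocks containing one of $1,\dots,r$ are called distinguished, all other blocks non-distinguished. Such a partition is Whitney colored with $m$ colors if every element that lies in a non-distinguished block and is not the smallest element of its block is assigned one of $m$ colors, while the elements of the distinguished blocks and the smallest elements of the blocks are not colored. Let the $s$-associated $r$-Whitney number $W_{n,k}=W_{n,k,m,r}^{\ge s}$ be the number of Whitney colored $r$-partitions of $[r+n]$ with $m$ colors that have exactly $k$ non-distinguished blocks, each of them containing at least $s$ elements. Then for all complex $x,z$ $$\sum_{n\ge 0}\Big(\sum_{k=0}^n W_{n,k}x^k\Big)\frac{z^n}{n!}=\exp\Big\{rz+\frac xm\Big(e^{mz}-\sum_{j=0}^{s-1}\frac{(mz)^j}{j!}\Big)\Big\}.$$ Moreover, for every $n\ge s$ the row sum $\sum_j W_{n,j}$ is positive, and if $X_n$ is a random variable with $\mathbf P(X_n=k)=W_{n,k}/\sum_j W_{n,j}$, $0\le k\le n$ (the number of non-distinguished blocks of a uniformly random such partition), then, as $n\to\infty$,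 $$\mathbf E X_n\sim\frac n{\log n},\qquad \operatorname{Var}(X_n)\sim\frac n{\log^2 n},$$ and $X_n$ is asymptotically normal: $$\frac{X_n-\mathbf E X_n}{\sqrt{\operatorname{Var}(X_n)}}\longrightarrow N(0,1)\quad\text{in distribution},$$ that is, $\mathbf P\big(X_n-\mathbf E X_n\le t\sqrt{\operatorname{Var}(X_n)}\big)\to\frac1{\sqrt{2\pi}}\int_{-\infty}^t e^{-u^2/2}\,du$ for every real $t$. -/

import Mathlib

open Finset MeasureTheory ProbabilityTheory Filter Topology Asymptotics

/-- A block `B` of a set partition of `Fin (r + n)` is distinguished if it contains one of the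
first `r` elements (these are the distinguished elements). -/
def IsDistinguished (r n : ℕ) (B : Finset (Fin (r + n))) : Prop :=
  ∃ i : Fin r, Fin.castAdd n i ∈ B

/-- A set partition `P` of `Fin (r + n)` together with a (partial) coloring of its elements by
`m` colors (`none` means "not colored") is a Whitney colored `r`-partition with `m` colors if
the first `r` elements lie in different blocks, and the elements that are not colored are
exactly the smallest elements of the blocks and the elements of the distinguished blocks. -/
structure IsWhitneyColored (r m n : ℕ) (P : Finpartition (univ : Finset (Fin (r + n))))
    (color : Fin (r + n) → Option (Fin m)) : Prop where
  separated : ∀ i j : Fin r, i ≠ j → ∀ B ∈ P.parts, Fin.castAdd n i ∈ B → Fin.castAdd n j ∉ B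
  not_colored_iff : ∀ B ∈ P.parts, ∀ a ∈ B,
    (color a = none ↔ (∀ b ∈ B, a ≤ b) ∨ IsDistinguished r n B)

open Classical in
/-- The non-distinguished blocks of a set partition of `Fin (r + n)`. -/
noncomputable def nonDistinguishedBlocks (r n : ℕ)
    (P : Finpartition (univ : Finset (Fin (r + n)))) : Finset (Finset (Fin (r + n))) :=
  {B ∈ P.parts | ¬ IsDistinguished r n B}

/-- The `s`-associated `r`-Whitney number `W_{n,k}`: the number of Whitney colored
`r`-partitions of `Fin (r + n)` with `m` colors in which every non-distinguished block has at
least `s` elements and which have exactly `k` non-distinguished blocks. -/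
noncomputable def assocWhitney (r m s n k : ℕ) : ℕ :=
  Nat.card {p : Finpartition (univ : Finset (Fin (r + n))) × (Fin (r + n) → Option (Fin m)) //
    IsWhitneyColored r m n p.1 p.2 ∧
    (∀ B ∈ nonDistinguishedBlocks r n p.1, s ≤ #B) ∧
    #(nonDistinguishedBlocks r n p.1) = k}

/-- The row sum `∑_k W_{n,k}`. -/
noncomputable def assocDowling (r m s n : ℕ) : ℕ :=
  ∑ k ∈ range (n + 1), assocWhitney r m s n k

/-- The law of the number `X_n` of non-distinguished blocks, `P(X_n = k) = W_{n,k} / ∑_j W_{n,j}`,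
as a measure on `ℝ`. It is a probability measure as soon as the row sum is nonzero, in particular
for all `n ≥ s`; otherwise it is the zero measure. -/
noncomputable def blockLaw (r m s n : ℕ) : Measure ℝ :=
  ∑ k ∈ range (n + 1),
    ENNReal.ofReal ((assocWhitney r m s n k : ℝ) / (assocDowling r m s n : ℝ)) •
      Measure.dirac (k : ℝ)

/-- The mean of the number of non-distinguished blocks. -/
noncomputable def blockMean (r m s n : ℕ) : ℝ := ∫ x, x ∂(blockLaw r m s n)

/-- The variance of the number of non-distinguished blocks. -/
noncomputable def blockVariance (r m s n : ℕ) : ℝ := variance id (blockLaw r m s n)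

/-! Generating function. Once the partition is fixed, the colorings of distinct blocks are
independent, so the row polynomial is a sum over set partitions of products of block weights
(`sum_assocWhitney_mul_pow_eq_sum_prod`). Splitting off the block of one chosen element gives a
recursion in the numbers of distinguished and ordinary elements (`sum_prod_whitneyWeight`). By the
Leibniz rule, the derivatives at 0 of the claimed function satisfy the same recursion. This function
is entire, so its Taylor series is the asserted sum.

Asymptotics. Put `w = m z`, `κ = 1/m`, `ρ = r/m`. With `x = exp u` and `w = y exp v` the exponent
is, up to terms independent of the block count, a Poisson sum over block sizes: blocks of size `j ≥
s` have intensity `κ y^j/j!`, and distinguished blocks add intensity `ρ y` to the total size. Its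
second order expansion in `(u, v)` therefore has the moments `M_i = blockMoment κ s i y` as
coefficients. Choose `y` with mean size `M_1 + ρ y = n` (`exists_saddlePoint`) and extract the
`n`-th coefficient by Cauchy's integral along `v = -c u + iθ`, where `c` is the regression
coefficient of the block count on the size. This choice kills the cross term `uθ`
(`gfExponent_sub_eq`), leaving `exp(M_0 u + σ² u²/2)`, with `σ²` the residual variance, times a
nearly Gaussian integral in `θ`.

That integral is asymptotically independent of `u` for complex `|u| ≤ exp(-9y/20)`
(`tendsto_sqrt_mul_integral_saddleExponent`). Dividing by the case `u = 0` shows that the moment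
generating function of `(X_n - M_0)/σ` tends to `exp(t²/2)`, even for moving complex `t`
(`tendsto_scaledMGF`). Locally uniform convergence of holomorphic functions passes to derivatives,
which gives mean and variance; imaginary `t` gives characteristic functions and the limit law.
Finally `n ~ κ y e^y`, `log n ~ y`, `M_0 ~ κ e^y` and `σ² ~ κ e^y/y`. -/

/-! ### Recursion for weighted sums over set partitions -/

/-- A partition is determined by the block `insert a C` of `a` together with the partition it
induces on the remaining elements. -/
theorem Finpartition.sum_prod_parts_eq_sum_powerset {α R : Type*} [DecidableEq α] [CommSemiring R]
    (w : Finset α → R) {A : Finset α} {a : α} (ha : a ∈ A) :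
    ∑ P : Finpartition A, ∏ B ∈ P.parts, w B =
      ∑ C ∈ (A.erase a).powerset, w (insert a C) *
        ∑ P : Finpartition (A.erase a \ C), ∏ B ∈ P.parts, w B := by
  have hne : ∀ C : Finset α, insert a C ≠ ⊥ := fun C => insert_ne_empty a C
  have hdis : ∀ C : Finset α, Disjoint (A.erase a \ C) (insert a C) := by
    intro C
    rw [disjoint_left]
    intro x hx hx'
    simp only [Finset.mem_sdiff, mem_erase, mem_insert] at hx hx'
    tauto
  have hsup : ∀ C ∈ (A.erase a).powerset, (A.erase a \ C) ⊔ insert a C = A := by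
    intro C hC
    ext x
    have hC' := mem_powerset.1 hC
    have := @hC' x
    by_cases hx : x = a
    · subst hx; simp [ha]
    · simp only [sup_eq_union, mem_union, Finset.mem_sdiff, mem_erase, mem_insert] at *
      tauto
  have hnot : ∀ C : Finset α, ∀ P : Finpartition (A.erase a \ C), insert a C ∉ P.parts := by
    intro C P h
    have := P.subset h (mem_insert_self a C)
    simp at this
  simp_rw [mul_sum]
  rw [Finset.sum_sigma']
  symm
  refine Finset.sum_bij (fun p hp => p.2.extend (hne p.1) (hdis p.1) (hsup p.1 (mem_sigma.1 hp).1))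
    (fun _ _ => mem_univ _) ?_ ?_ ?_
  · rintro ⟨C, P⟩ hp ⟨C', P'⟩ hp' h
    have hC := mem_powerset.1 (mem_sigma.1 hp).1
    have hC' := mem_powerset.1 (mem_sigma.1 hp').1
    have hparts := congrArg Finpartition.parts h
    simp only [Finpartition.extend_parts] at hparts
    have h1 : insert a C ∈ insert (insert a C') P'.parts := hparts ▸ mem_insert_self _ _
    have h2 : insert a C = insert a C' := by
      rcases mem_insert.1 h1 with h1 | h1
      · exact h1
      · have := P'.subset h1 (mem_insert_self a C)
        simp at this
    have h3 : C = C' := by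
      have e1 : (insert a C).erase a = C := erase_insert (fun h => by simpa using hC h)
      have e2 : (insert a C').erase a = C' := erase_insert (fun h => by simpa using hC' h)
      rw [← e1, ← e2, h2]
    subst h3
    have h4 : P.parts = P'.parts := by
      rw [← erase_insert (hnot C P), ← erase_insert (hnot C P'), hparts]
    rw [Finpartition.ext h4]
  · intro P _
    have hpa : a ∈ P.part a := P.mem_part_self.2 ha
    have hsub : (P.part a).erase a ∈ (A.erase a).powerset :=
      mem_powerset.2 (erase_subset_erase a (P.part_subset a))
    refine ⟨⟨(P.part a).erase a, P.ofSubset (erase_subset (P.part a) P.parts) ?_⟩,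
      mem_sigma.2 ⟨hsub, mem_univ _⟩, ?_⟩
    · ext x
      simp only [Finset.mem_sup, mem_erase, id, Finset.mem_sdiff]
      constructor
      · rintro ⟨B, ⟨hB, hBP⟩, hx⟩
        have hxa : x ∉ P.part a := fun h =>
          hB (P.eq_of_mem_parts hBP (P.part_mem.2 ha) hx h)
        refine ⟨⟨fun h => hxa (h ▸ hpa), P.subset hBP hx⟩, fun h => hxa h.2⟩
      · rintro ⟨⟨hxa, hxA⟩, hx⟩
        obtain ⟨B, hB, hxB⟩ := P.exists_mem hxA
        exact ⟨B, ⟨fun h => hx ⟨hxa, h ▸ hxB⟩, hB⟩, hxB⟩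
    · apply Finpartition.ext
      simp only [Finpartition.extend_parts, Finpartition.ofSubset_parts]
      rw [insert_erase hpa, insert_erase (P.part_mem.2 ha)]
  · rintro ⟨C, P⟩ _
    simp only [Finpartition.extend_parts]
    rw [prod_insert (hnot C P)]

/-- The weight of a block `B` with `D` the set of distinguished elements. -/
noncomputable def whitneyWeight {α : Type*} [DecidableEq α] (D : Finset α) (m s : ℕ) (x : ℂ)
    (B : Finset α) : ℂ :=
  if #(B ∩ D) = 0 then (if s ≤ #B then x * (m : ℂ) ^ (#B - 1) else 0)
  else if #(B ∩ D) = 1 then 1 else 0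

/-- Strong induction on the size of `A`, splitting off the block of a distinguished element as long
as one is left. The answer depends only on the two cardinalities, so any `h` obeying the recursions
must agree with it. -/
theorem sum_prod_whitneyWeight {α : Type*} [DecidableEq α] (D : Finset α) (m s : ℕ) (x : ℂ)
    (h : ℕ → ℕ → ℂ) (h00 : h 0 0 = 1)
    (h0 : ∀ n, h 0 (n + 1) = ∑ j ∈ range (n + 1),
      (n.choose j : ℂ) * (if s ≤ j + 1 then x * (m : ℂ) ^ j else 0) * h 0 (n - j))
    (hd : ∀ d n, h (d + 1) n = ∑ j ∈ range (n + 1), (n.choose j : ℂ) * h d (n - j))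
    (A : Finset α) :
    ∑ P : Finpartition A, ∏ B ∈ P.parts, whitneyWeight D m s x B = h #(A ∩ D) #(A \ D) := by
  induction hN : #A using Nat.strong_induction_on generalizing A with
  | _ N ih =>
  subst hN
  rcases A.eq_empty_or_nonempty with rfl | hA
  · have : ∀ P : Finpartition (∅ : Finset α), P.parts = ∅ := fun P =>
      Finpartition.parts_eq_empty_iff.2 rfl
    simp only [this, prod_empty, sum_const, empty_inter, empty_sdiff, card_empty, h00]
    have h1 : #(univ : Finset (Finpartition (∅ : Finset α))) = 1 := by
      rw [card_eq_one]
      refine ⟨Finpartition.empty (Finset α), ?_⟩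
      ext P
      simp only [mem_univ, mem_singleton, true_iff]
      apply Finpartition.ext
      rw [this P, this]
    simp [h1]
  have ihC : ∀ a ∈ A, ∀ C : Finset α, #(A.erase a \ C) < #A := fun a ha C =>
    (card_le_card sdiff_subset).trans_lt (card_erase_lt_of_mem ha)
  by_cases hAD : (A ∩ D).Nonempty
  · obtain ⟨a, haAD⟩ := hAD
    obtain ⟨ha, haD⟩ := mem_inter.1 haAD
    rw [Finpartition.sum_prod_parts_eq_sum_powerset _ ha]
    have hcard : #(A ∩ D) = #((A.erase a) ∩ D) + 1 := by
      rw [← card_erase_add_one haAD, erase_inter]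
    have hsub : (A \ D).powerset ⊆ (A.erase a).powerset := by
      rw [powerset_mono]
      intro y hy
      rw [Finset.mem_sdiff] at hy
      exact mem_erase.2 ⟨fun h => hy.2 (h ▸ haD), hy.1⟩
    -- A block of `a ∈ D` that contains a second element of `D` has weight 0, so only companions
    -- from `A \ D` matter.
    rw [← sum_subset hsub, hcard, hd]
    · have := sum_powerset_apply_card (fun j => h #((A.erase a) ∩ D) (#(A \ D) - j)) (x := A \ D)
      simp only [nsmul_eq_mul] at this
      rw [← this]
      refine sum_congr rfl fun C hC => ?_
      rw [mem_powerset] at hC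
      have hCD : C ∩ D = ∅ := by
        ext y
        have := @hC y
        simp only [mem_inter, Finset.mem_sdiff, notMem_empty] at *
        tauto
      have hw : whitneyWeight D m s x (insert a C) = 1 := by
        have : insert a C ∩ D = {a} := by
          rw [insert_inter_of_mem haD, hCD]; rfl
        simp [whitneyWeight, this]
      rw [hw, one_mul, ih _ (ihC a ha C) _ rfl]
      congr 1
      · congr 1
        ext y
        have := @hC y
        simp only [mem_inter, Finset.mem_sdiff, mem_erase] at *
        tauto
      · rw [← card_sdiff_of_subset hC]
        congr 1
        ext y
        simp only [Finset.mem_sdiff, mem_erase]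
        constructor
        · tauto
        · rintro ⟨⟨h1, h2⟩, h3⟩
          exact ⟨⟨⟨fun h => h2 (h ▸ haD), h1⟩, h3⟩, h2⟩
    · intro C hC hC'
      have hw : whitneyWeight D m s x (insert a C) = 0 := by
        rw [mem_powerset] at hC hC'
        obtain ⟨y, hy, hy'⟩ := not_subset.1 hC'
        have hyA := hC hy
        rw [mem_erase] at hyA
        have hyD : y ∈ D := by
          by_contra hh
          exact hy' (Finset.mem_sdiff.2 ⟨hyA.2, hh⟩)
        have : 1 < #(insert a C ∩ D) := by
          rw [one_lt_card]
          exact ⟨a, by simp [haD], y, by simp [hy, hyD], hyA.1.symm⟩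
        unfold whitneyWeight
        rw [if_neg (by omega), if_neg (by omega)]
      rw [hw, zero_mul]
  · rw [not_nonempty_iff_eq_empty] at hAD
    obtain ⟨a, ha⟩ := hA
    have hAD' : A \ D = A := by
      rw [Finset.sdiff_eq_self_iff_disjoint, disjoint_iff_inter_eq_empty, hAD]
    rw [Finpartition.sum_prod_parts_eq_sum_powerset _ ha, hAD, hAD', card_empty,
      ← card_erase_add_one ha, h0]
    have := sum_powerset_apply_card (fun j => (if s ≤ j + 1 then x * (m : ℂ) ^ j else 0)
      * h 0 (#(A.erase a) - j)) (x := A.erase a)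
    simp only [nsmul_eq_mul, ← mul_assoc] at this
    rw [← this]
    refine sum_congr rfl fun C hC => ?_
    rw [mem_powerset] at hC
    have haC : a ∉ C := fun h => by simpa using hC h
    have hsubA : ∀ B ⊆ A, B ∩ D = ∅ := fun B hB =>
      subset_empty.1 (hAD ▸ inter_subset_inter_right hB)
    have hCA : insert a C ⊆ A := insert_subset ha (hC.trans (erase_subset _ _))
    have hBA : A.erase a \ C ⊆ A := sdiff_subset.trans (erase_subset _ _)
    rw [ih _ (ihC a ha C) _ rfl, hsubA _ hBA, card_empty,
      sdiff_eq_self_of_disjoint (disjoint_iff_inter_eq_empty.2 (hsubA _ hBA)),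
      card_sdiff_of_subset hC]
    simp [whitneyWeight, hsubA _ hCA, card_insert_of_notMem haC]

/-! ### Row polynomials as weighted sums over partitions -/

/-- The distinguished elements of `Fin (r + n)`. -/
noncomputable def distinguishedElements (r n : ℕ) : Finset (Fin (r + n)) :=
  univ.map ⟨Fin.castAdd n, Fin.castAdd_injective r n⟩

theorem mem_distinguishedElements {r n : ℕ} {a : Fin (r + n)} :
    a ∈ distinguishedElements r n ↔ ∃ i : Fin r, Fin.castAdd n i = a := by
  simp [distinguishedElements]

theorem card_distinguishedElements (r n : ℕ) : #(distinguishedElements r n) = r := by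
  simp [distinguishedElements]

theorem isDistinguished_iff {r n : ℕ} {B : Finset (Fin (r + n))} :
    IsDistinguished r n B ↔ #(B ∩ distinguishedElements r n) ≠ 0 := by
  rw [card_ne_zero]
  constructor
  · rintro ⟨i, hi⟩
    exact ⟨_, mem_inter.2 ⟨hi, mem_distinguishedElements.2 ⟨i, rfl⟩⟩⟩
  · rintro ⟨a, ha⟩
    obtain ⟨ha, hd⟩ := mem_inter.1 ha
    obtain ⟨i, rfl⟩ := mem_distinguishedElements.1 hd
    exact ⟨i, ha⟩

theorem separated_iff {r n : ℕ} (P : Finpartition (univ : Finset (Fin (r + n)))) :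
    (∀ i j : Fin r, i ≠ j → ∀ B ∈ P.parts, Fin.castAdd n i ∈ B → Fin.castAdd n j ∉ B) ↔
      ∀ B ∈ P.parts, #(B ∩ distinguishedElements r n) ≤ 1 := by
  simp only [card_le_one, mem_inter, mem_distinguishedElements]
  constructor
  · rintro h B hB _ ⟨ha, i, rfl⟩ _ ⟨hb, j, rfl⟩
    by_contra hne
    exact h i j (fun e => hne (e ▸ rfl)) B hB ha hb
  · intro h i j hij B hB hi hj
    exact hij (Fin.castAdd_injective r n (h B hB _ ⟨hi, i, rfl⟩ _ ⟨hj, j, rfl⟩))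

-- The coloring condition constrains each element separately. In a non-distinguished block every
-- element except the minimum has `m` choices; all other elements are forced to `none`.
open Classical in
theorem card_colorings (r m n : ℕ) (P : Finpartition (univ : Finset (Fin (r + n)))) :
    #{color : Fin (r + n) → Option (Fin m) | ∀ B ∈ P.parts, ∀ a ∈ B,
      (color a = none ↔ (∀ b ∈ B, a ≤ b) ∨ IsDistinguished r n B)} =
    ∏ B ∈ nonDistinguishedBlocks r n P, m ^ (#B - 1) := by
  let c : Fin (r + n) → Prop := fun a => (∀ b ∈ P.part a, a ≤ b) ∨ IsDistinguished r n (P.part a)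
  have h1 : ({color : Fin (r + n) → Option (Fin m) | ∀ B ∈ P.parts, ∀ a ∈ B,
      (color a = none ↔ (∀ b ∈ B, a ≤ b) ∨ IsDistinguished r n B)} : Finset _) =
      Fintype.piFinset (fun a => if c a then {none} else univ.erase none) := by
    ext color
    simp only [mem_filter, mem_univ, true_and, Fintype.mem_piFinset]
    have : ∀ a, (color a ∈ (if c a then {none} else univ.erase none : Finset (Option (Fin m)))) ↔
        (color a = none ↔ c a) := by
      intro a
      by_cases h : c a <;> simp [h]
    simp only [this]
    constructor
    · intro h a
      exact h (P.part a) (P.part_mem.2 (mem_univ a)) a (P.mem_part_self.2 (mem_univ a))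
    · intro h B hB a ha
      rw [h a]
      simp only [c, P.part_eq_of_mem hB ha]
  rw [h1, Fintype.card_piFinset]
  have h2 : ∏ a, #(if c a then {none} else univ.erase none : Finset (Option (Fin m))) =
      ∏ B ∈ P.parts, ∏ a ∈ B,
        #(if c a then {none} else univ.erase none : Finset (Option (Fin m))) := by
    have key : ∀ f : Fin (r + n) → ℕ, ∏ a, f a = ∏ B ∈ P.parts, ∏ a ∈ B, f a := by
      intro f
      refine (congrArg (fun A => ∏ a ∈ A, f a) P.biUnion_parts).symm.trans ?_
      exact prod_biUnion P.supIndep.pairwiseDisjoint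
    exact key _
  rw [h2, nonDistinguishedBlocks, prod_filter]
  refine prod_congr rfl fun B hB => ?_
  have h3 : ∀ a ∈ B, (c a ↔ (∀ b ∈ B, a ≤ b) ∨ IsDistinguished r n B) := fun a ha => by
    simp only [c, P.part_eq_of_mem hB ha]
  by_cases hd : IsDistinguished r n B
  · rw [if_neg (not_not.2 hd)]
    refine prod_eq_one fun a ha => ?_
    rw [if_pos ((h3 a ha).2 (Or.inr hd)), card_singleton]
  · rw [if_pos hd]
    have hne := P.nonempty_of_mem_parts hB
    rw [← mul_prod_erase B _ (B.min'_mem hne)]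
    have h4 : c (B.min' hne) := (h3 _ (B.min'_mem hne)).2 (Or.inl fun b hb => B.min'_le b hb)
    rw [if_pos h4, card_singleton, one_mul, ← card_erase_of_mem (B.min'_mem hne), ← prod_const]
    refine prod_congr rfl fun a ha => ?_
    obtain ⟨hne', ha⟩ := mem_erase.1 ha
    have h5 : ¬ c a := by
      rw [h3 a ha]
      rintro (h | h)
      · exact hne' (le_antisymm (h _ (B.min'_mem hne)) (B.min'_le a ha))
      · exact hd h
    simp [if_neg h5]

open Classical in
theorem assocWhitney_eq_sum (r m s n k : ℕ) :
    assocWhitney r m s n k = ∑ P : Finpartition (univ : Finset (Fin (r + n))),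
      if ((∀ B ∈ P.parts, #(B ∩ distinguishedElements r n) ≤ 1) ∧
        ∀ B ∈ nonDistinguishedBlocks r n P, s ≤ #B) ∧ #(nonDistinguishedBlocks r n P) = k
      then ∏ B ∈ nonDistinguishedBlocks r n P, m ^ (#B - 1) else 0 := by
  rw [assocWhitney, Nat.card_eq_fintype_card, Fintype.card_subtype, card_filter,
    ← univ_product_univ, sum_product]
  refine sum_congr rfl fun P _ => ?_
  rw [← card_colorings, ← card_filter]
  split_ifs with h
  · congr 1
    ext color
    simp only [mem_filter, mem_univ, true_and]
    constructor
    · rintro ⟨h1, -⟩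
      exact h1.not_colored_iff
    · intro h1
      exact ⟨⟨(separated_iff P).2 h.1.1, h1⟩, h.1.2, h.2⟩
  · rw [card_eq_zero, filter_eq_empty_iff]
    rintro color - ⟨h1, h2, h3⟩
    exact h ⟨⟨(separated_iff P).1 h1.separated, h2⟩, h3⟩

theorem card_nonDistinguishedBlocks_le (r n : ℕ)
    (P : Finpartition (univ : Finset (Fin (r + n)))) : #(nonDistinguishedBlocks r n P) ≤ n := by
  classical
  have h1 : ∀ B ∈ nonDistinguishedBlocks r n P, (B : Finset _).Nonempty := fun B hB =>
    P.nonempty_of_mem_parts (mem_filter.1 hB).1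
  have h2 : (nonDistinguishedBlocks r n P).biUnion id ⊆ univ \ distinguishedElements r n := by
    intro a ha
    obtain ⟨B, hB, haB⟩ := mem_biUnion.1 ha
    refine Finset.mem_sdiff.2 ⟨mem_univ a, fun hd => ?_⟩
    obtain ⟨i, rfl⟩ := mem_distinguishedElements.1 hd
    exact (mem_filter.1 hB).2 ⟨i, haB⟩
  have h3 : #(univ \ distinguishedElements r n) = n := by
    rw [card_sdiff_of_subset (subset_univ _), card_distinguishedElements]; simp
  refine le_of_le_of_eq (le_trans ?_ (card_le_card h2)) h3
  refine card_le_card_biUnion ?_ h1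
  exact P.supIndep.pairwiseDisjoint.subset (filter_subset _ _)

theorem sum_assocWhitney_mul_pow_eq_sum_prod (r m s n : ℕ) (x : ℂ) :
    ∑ k ∈ range (n + 1), (assocWhitney r m s n k : ℂ) * x ^ k =
      ∑ P : Finpartition (univ : Finset (Fin (r + n))),
        ∏ B ∈ P.parts, whitneyWeight (distinguishedElements r n) m s x B := by
  classical
  simp only [assocWhitney_eq_sum, Nat.cast_sum, sum_mul]
  rw [sum_comm]
  refine sum_congr rfl fun P _ => ?_
  have hnd : ∀ B, B ∈ nonDistinguishedBlocks r n P ↔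
      B ∈ P.parts ∧ #(B ∩ distinguishedElements r n) = 0 := by
    intro B
    rw [nonDistinguishedBlocks, mem_filter, isDistinguished_iff, not_not]
  by_cases hg : (∀ B ∈ P.parts, #(B ∩ distinguishedElements r n) ≤ 1) ∧
      ∀ B ∈ nonDistinguishedBlocks r n P, s ≤ #B
  · simp only [eq_true hg, true_and]
    -- For fixed `P` only one `k` contributes, and it lies in the range because disjoint nonempty
    -- blocks inside an `n`-element set number at most `n`.
    rw [sum_eq_single_of_mem #(nonDistinguishedBlocks r n P)
      (mem_range.2 (Nat.lt_succ_of_le (card_nonDistinguishedBlocks_le r n P)))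
      (fun k _ hk => by simp [hk.symm])]
    rw [if_pos rfl, Nat.cast_prod, ← prod_const, ← prod_mul_distrib]
    have hsub : nonDistinguishedBlocks r n P ⊆ P.parts := filter_subset _ _
    rw [← prod_subset hsub]
    · refine prod_congr rfl fun B hB => ?_
      rw [whitneyWeight, if_pos ((hnd B).1 hB).2, if_pos (hg.2 B hB)]
      push_cast
      ring
    · intro B hB hB'
      have h0 : #(B ∩ distinguishedElements r n) ≠ 0 := fun h => hB' ((hnd B).2 ⟨hB, h⟩)
      have h1 := hg.1 B hB
      rw [whitneyWeight, if_neg h0, if_pos (by omega)]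
  · simp only [hg, false_and, if_false, Nat.cast_zero, zero_mul, sum_const_zero]
    rw [not_and_or] at hg
    push Not at hg
    symm
    rcases hg with ⟨B, hB, h⟩ | ⟨B, hB, h⟩
    · refine prod_eq_zero hB ?_
      rw [whitneyWeight, if_neg (by omega), if_neg (by omega)]
    · refine prod_eq_zero ((hnd B).1 hB).1 ?_
      rw [whitneyWeight, if_pos ((hnd B).1 hB).2, if_neg (by omega)]

/-! ### The exponential generating function -/

theorem hasDerivAt_sum_pow_div_factorial (s : ℕ) (w : ℂ) :
    HasDerivAt (fun w : ℂ => ∑ j ∈ range (s + 1), w ^ j / (j.factorial : ℂ))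
      (∑ j ∈ range s, w ^ j / (j.factorial : ℂ)) w := by
  simp only [sum_range_succ' _ s, pow_zero]
  refine HasDerivAt.add_const _ (HasDerivAt.fun_sum fun j _ => ?_)
  have h := (hasDerivAt_pow (j + 1) w).div_const ((j + 1).factorial : ℂ)
  convert! h using 1
  have h1 : (j.factorial : ℂ) ≠ 0 := by exact_mod_cast j.factorial_ne_zero
  have h2 : ((j : ℂ) + 1) ≠ 0 := by exact_mod_cast j.succ_ne_zero
  rw [Nat.factorial_succ, Nat.add_sub_cancel]
  push_cast
  field_simp

theorem iteratedDeriv_exp_sub_sum_zero (s k : ℕ) :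
    iteratedDeriv k (fun w : ℂ => Complex.exp w - ∑ j ∈ range s, w ^ j / (j.factorial : ℂ)) 0 =
      if s ≤ k then 1 else 0 := by
  have hk : ∀ j, ContDiffAt ℂ k (fun w : ℂ => w ^ j / (j.factorial : ℂ)) 0 := fun j => by fun_prop
  rw [iteratedDeriv_fun_sub (by fun_prop) (by fun_prop), iteratedDeriv_fun_sum (fun j _ => hk j)]
  have h1 : ∀ j, iteratedDeriv k (fun w : ℂ => w ^ j / (j.factorial : ℂ)) 0 =
      if k = j then 1 else 0 := by
    intro j
    simp only [div_eq_mul_inv]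
    rw [iteratedDeriv_mul_const_field, iteratedDeriv_pow]
    rcases lt_trichotomy k j with h | rfl | h
    · rw [if_neg h.ne, zero_pow (by omega)]; simp
    · rw [if_pos rfl, Nat.sub_self, Nat.descFactorial_self]
      have h1 : (k.factorial : ℂ) ≠ 0 := by exact_mod_cast k.factorial_ne_zero
      field_simp
    · rw [if_neg h.ne', Nat.descFactorial_of_lt h]; simp
  simp only [h1, sum_ite_eq, mem_range]
  rw [iteratedDeriv_eq_iterate, Complex.iter_deriv_exp]
  by_cases h : s ≤ k
  · simp [h, not_lt.2 h]
  · simp [h, not_le.1 h]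

/-- The exponential generating function of the row polynomials of the associated Whitney numbers. -/
noncomputable def whitneyGF (r m s : ℕ) (x z : ℂ) : ℂ :=
  Complex.exp ((r : ℂ) * z + x / (m : ℂ) * (Complex.exp ((m : ℂ) * z)
    - ∑ j ∈ range s, ((m : ℂ) * z) ^ j / (j.factorial : ℂ)))

theorem contDiff_whitneyGF (r m s : ℕ) (x : ℂ) (k : WithTop ℕ∞) :
    ContDiff ℂ k (whitneyGF r m s x) := by
  unfold whitneyGF
  fun_prop

/-- One more distinguished element multiplies the function by `exp z`, all of whose derivatives at 0
are 1; the rest is the Leibniz rule. -/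
theorem iteratedDeriv_whitneyGF_succ (r m s : ℕ) (x : ℂ) (n : ℕ) :
    iteratedDeriv n (whitneyGF (r + 1) m s x) 0 = ∑ j ∈ range (n + 1),
      (n.choose j : ℂ) * iteratedDeriv (n - j) (whitneyGF r m s x) 0 := by
  have h : whitneyGF (r + 1) m s x = Complex.exp * whitneyGF r m s x := by
    ext z
    rw [Pi.mul_apply, whitneyGF, whitneyGF, ← Complex.exp_add]
    congr 1
    push_cast
    ring
  rw [h, iteratedDeriv_mul (by fun_prop) (contDiff_whitneyGF ..).contDiffAt]
  refine sum_congr rfl fun j _ => ?_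
  rw [iteratedDeriv_eq_iterate, Complex.iter_deriv_exp]
  simp

/-- Differentiating the truncated exponential removes one more term of the head, which is why the
head on the right stops at `s` and not at `s + 1`: the element split off already counts towards the
block size. -/
theorem deriv_whitneyGF_zero {m : ℕ} (hm : 1 ≤ m) (s : ℕ) (x : ℂ) :
    deriv (whitneyGF 0 m (s + 1) x) = (fun z => x * (fun w : ℂ => Complex.exp w -
      ∑ j ∈ range s, w ^ j / (j.factorial : ℂ)) ((m : ℂ) * z)) * whitneyGF 0 m (s + 1) x := by
  have hm' : (m : ℂ) ≠ 0 := by exact_mod_cast (by omega : m ≠ 0)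
  ext z
  have h1 : HasDerivAt (fun z : ℂ => (m : ℂ) * z) m z := by
    simpa using (hasDerivAt_id z).const_mul (m : ℂ)
  have h2 := (((Complex.hasDerivAt_exp _).comp z h1).sub
    ((hasDerivAt_sum_pow_div_factorial s _).comp z h1)).const_mul (x / (m : ℂ))
  have h4 : HasDerivAt (whitneyGF 0 m (s + 1) x) (((fun z => x * (fun w : ℂ => Complex.exp w -
      ∑ j ∈ range s, w ^ j / (j.factorial : ℂ)) ((m : ℂ) * z)) * whitneyGF 0 m (s + 1) x) z) z := by
    have h5 : HasDerivAt (fun z : ℂ => x / (m : ℂ) * (Complex.exp ((m : ℂ) * z)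
        - ∑ j ∈ range (s + 1), ((m : ℂ) * z) ^ j / (j.factorial : ℂ)))
        (x / (m : ℂ) * (Complex.exp ((m : ℂ) * z) * m
        - (∑ j ∈ range s, ((m : ℂ) * z) ^ j / (j.factorial : ℂ)) * m)) z := h2
    have h6 := h5.cexp
    have h7 : whitneyGF 0 m (s + 1) x = fun z : ℂ => Complex.exp (x / (m : ℂ) *
        (Complex.exp ((m : ℂ) * z)
        - ∑ j ∈ range (s + 1), ((m : ℂ) * z) ^ j / (j.factorial : ℂ))) := by
      ext z; simp [whitneyGF]
    rw [h7]
    convert! h6 using 1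
    rw [Pi.mul_apply]
    field_simp
  exact h4.deriv

theorem iteratedDeriv_whitneyGF_zero {m : ℕ} (hm : 1 ≤ m) {s : ℕ} (hs : 1 ≤ s) (x : ℂ) (n : ℕ) :
    iteratedDeriv (n + 1) (whitneyGF 0 m s x) 0 = ∑ j ∈ range (n + 1),
      (n.choose j : ℂ) * (if s ≤ j + 1 then x * (m : ℂ) ^ j else 0) *
        iteratedDeriv (n - j) (whitneyGF 0 m s x) 0 := by
  obtain ⟨s, rfl⟩ := Nat.exists_eq_add_of_le' hs
  rw [iteratedDeriv_succ', deriv_whitneyGF_zero hm,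
    iteratedDeriv_mul (by fun_prop) (contDiff_whitneyGF ..).contDiffAt]
  refine sum_congr rfl fun j _ => ?_
  have hc := congrFun (iteratedDeriv_comp_const_mul (n := j) (f := fun w : ℂ => Complex.exp w -
    ∑ j ∈ range s, w ^ j / (j.factorial : ℂ)) (by fun_prop) (m : ℂ)) 0
  simp only [mul_zero, iteratedDeriv_exp_sub_sum_zero] at hc
  rw [iteratedDeriv_const_mul_field, hc]
  simp only [Nat.add_le_add_iff_right]
  congr 2
  split_ifs <;> simp

theorem sum_assocWhitney_mul_pow (r : ℕ) {m : ℕ} (hm : 1 ≤ m) {s : ℕ} (hs : 1 ≤ s) (n : ℕ) (x : ℂ) :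
    ∑ k ∈ range (n + 1), (assocWhitney r m s n k : ℂ) * x ^ k =
      iteratedDeriv n (whitneyGF r m s x) 0 := by
  rw [sum_assocWhitney_mul_pow_eq_sum_prod,
    sum_prod_whitneyWeight (distinguishedElements r n) m s x
      (fun d k => iteratedDeriv k (whitneyGF d m s x) 0)]
  · rw [univ_inter, card_distinguishedElements, card_sdiff_of_subset (subset_univ _),
      card_distinguishedElements]
    simp
  · obtain ⟨s, rfl⟩ := Nat.exists_eq_add_of_le' hs
    simp [whitneyGF, sum_range_succ']
  · exact iteratedDeriv_whitneyGF_zero hm hs x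
  · intro d k
    exact iteratedDeriv_whitneyGF_succ d m s x k

theorem hasSum_whitneyGF (r : ℕ) {m : ℕ} (hm : 1 ≤ m) {s : ℕ} (hs : 1 ≤ s) (x z : ℂ) :
    HasSum (fun n : ℕ => (∑ k ∈ range (n + 1), (assocWhitney r m s n k : ℂ) * x ^ k)
      * z ^ n / (n.factorial : ℂ)) (whitneyGF r m s x z) := by
  have h := Complex.hasSum_taylorSeries_of_entire
    ((contDiff_whitneyGF r m s x 1).differentiable (by norm_num)) 0 z
  convert! h using 2 with n
  rw [sum_assocWhitney_mul_pow r hm hs, sub_zero, smul_eq_mul, smul_eq_mul]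
  ring

/-! ### Moments of the block weights and the Taylor remainder -/

/-- The weight `κ y ^ j / j!` of the blocks of size `j ≥ s`. -/
noncomputable def blockWeight (κ : ℝ) (s : ℕ) (y : ℝ) (j : ℕ) : ℝ :=
  if s ≤ j then κ * (y ^ j / j.factorial) else 0

/-- The initial segment of the series of the moment `∑ j, j ^ i * y ^ j / j!`. -/
noncomputable def momentHead (s i : ℕ) (y : ℝ) : ℝ :=
  ∑ j ∈ range s, y ^ j / j.factorial * (j : ℝ) ^ i

/-- The moments of the block weights. -/
noncomputable def blockMoment (κ : ℝ) (s i : ℕ) (y : ℝ) : ℝ :=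
  κ * (∑' j : ℕ, y ^ j / j.factorial * (j : ℝ) ^ i - momentHead s i y)

theorem hasSum_pow_div_factorial_zero (y : ℝ) :
    HasSum (fun j : ℕ => y ^ j / j.factorial * (j : ℝ) ^ 0) (Real.exp y) := by
  simpa [Real.exp_eq_exp_ℝ] using NormedSpace.expSeries_div_hasSum_exp y

theorem hasSum_pow_div_factorial_one (y : ℝ) :
    HasSum (fun j : ℕ => y ^ j / j.factorial * (j : ℝ) ^ 1) (y * Real.exp y) := by
  rw [← hasSum_nat_add_iff' 1]
  have h := (hasSum_pow_div_factorial_zero y).mul_left y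
  simp only [range_one, sum_singleton, Nat.cast_zero, pow_one, mul_zero, sub_zero]
  convert! h using 2 with j
  have h1 : (j.factorial : ℝ) ≠ 0 := by exact_mod_cast j.factorial_ne_zero
  rw [Nat.factorial_succ]
  push_cast
  field_simp
  ring

theorem hasSum_pow_div_factorial_two (y : ℝ) :
    HasSum (fun j : ℕ => y ^ j / j.factorial * (j : ℝ) ^ 2) ((y ^ 2 + y) * Real.exp y) := by
  rw [← hasSum_nat_add_iff' 1]
  have h := ((hasSum_pow_div_factorial_one y).add (hasSum_pow_div_factorial_zero y)).mul_left y
  simp only [range_one, sum_singleton, Nat.cast_zero, zero_pow two_ne_zero, mul_zero, sub_zero]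
  convert! h using 1
  · ext j
    have h1 : (j.factorial : ℝ) ≠ 0 := by exact_mod_cast j.factorial_ne_zero
    rw [Nat.factorial_succ]
    push_cast
    field_simp
    ring
  · ring

theorem blockMoment_zero (κ : ℝ) (s : ℕ) (y : ℝ) :
    blockMoment κ s 0 y = κ * (Real.exp y - momentHead s 0 y) := by
  rw [blockMoment, (hasSum_pow_div_factorial_zero y).tsum_eq]

theorem blockMoment_one (κ : ℝ) (s : ℕ) (y : ℝ) :
    blockMoment κ s 1 y = κ * (y * Real.exp y - momentHead s 1 y) := by
  rw [blockMoment, (hasSum_pow_div_factorial_one y).tsum_eq]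

theorem blockMoment_two (κ : ℝ) (s : ℕ) (y : ℝ) :
    blockMoment κ s 2 y = κ * ((y ^ 2 + y) * Real.exp y - momentHead s 2 y) := by
  rw [blockMoment, (hasSum_pow_div_factorial_two y).tsum_eq]

theorem HasSum.sub_head {E : Type*} [AddCommGroup E] [TopologicalSpace E] [IsTopologicalAddGroup E]
    {g : ℕ → E} {a : E} (h : HasSum g a) (s : ℕ) :
    HasSum (fun j => if s ≤ j then g j else 0) (a - ∑ j ∈ range s, g j) := by
  have h1 : HasSum (fun j => if j < s then g j else 0) (∑ j ∈ range s, g j) := by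
    have := hasSum_sum_of_ne_finset_zero (f := fun j => if j < s then g j else 0) (s := range s)
      (fun j hj => if_neg (by simpa using hj)) (L := SummationFilter.unconditional ℕ)
    convert! this using 1
    exact sum_congr rfl fun j hj => (if_pos (mem_range.1 hj)).symm
  convert! h.sub h1 using 2 with j
  by_cases hj : s ≤ j
  · simp [hj, not_lt.2 hj]
  · simp [hj, not_le.1 hj]

theorem hasSum_blockWeight_mul_pow (κ : ℝ) (s i : ℕ) (hi : i ≤ 2) (y : ℝ) :
    HasSum (fun j => blockWeight κ s y j * (j : ℝ) ^ i) (blockMoment κ s i y) := by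
  have h : Summable (fun j : ℕ => y ^ j / j.factorial * (j : ℝ) ^ i) := by
    interval_cases i
    · exact (hasSum_pow_div_factorial_zero y).summable
    · exact (hasSum_pow_div_factorial_one y).summable
    · exact (hasSum_pow_div_factorial_two y).summable
  rw [blockMoment, momentHead]
  convert! (h.hasSum.sub_head s).mul_left κ using 2 with j
  rw [blockWeight]
  split_ifs <;> ring

theorem blockWeight_nonneg {κ : ℝ} (hκ : 0 ≤ κ) (s : ℕ) {y : ℝ} (hy : 0 ≤ y) (j : ℕ) :
    0 ≤ blockWeight κ s y j := by
  unfold blockWeight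
  split_ifs <;> positivity

theorem hasSum_blockWeight_mul_cexp (κ : ℝ) (s : ℕ) (y : ℝ) (u v : ℂ) :
    HasSum (fun j => (blockWeight κ s y j : ℂ) * Complex.exp (u + v * j))
      (Complex.exp u * κ * (Complex.exp (y * Complex.exp v) -
        ∑ j ∈ range s, ((y : ℂ) * Complex.exp v) ^ j / (j.factorial : ℂ))) := by
  have h : HasSum (fun j : ℕ => ((y : ℂ) * Complex.exp v) ^ j / (j.factorial : ℂ))
      (Complex.exp (y * Complex.exp v)) := by
    simpa [Complex.exp_eq_exp_ℂ] using NormedSpace.expSeries_div_hasSum_exp ((y : ℂ) * Complex.exp v)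
  convert! (h.sub_head s).mul_left (Complex.exp u * κ) using 2 with j
  rw [blockWeight]
  split_ifs
  · push_cast
    rw [mul_pow, ← Complex.exp_nat_mul, Complex.exp_add, mul_comm v]
    ring
  · simp

/-- The exponent of the generating function in the rescaled variable `w = m z`, with `ρ = r / m`
and `κ = 1 / m`. -/
noncomputable def gfExponent (κ ρ : ℝ) (s : ℕ) (x w : ℂ) : ℂ :=
  ρ * w + x * κ * (Complex.exp w - ∑ j ∈ range s, w ^ j / (j.factorial : ℂ))

/-- The remainder of the second order Taylor expansion of `gfExponent κ ρ s (exp u) (y * exp v)`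
in `u` and `v`. -/
noncomputable def gfRemainder (κ ρ : ℝ) (s : ℕ) (y : ℝ) (u v : ℂ) : ℂ :=
  gfExponent κ ρ s (Complex.exp u) (y * Complex.exp v) - gfExponent κ ρ s 1 y
    - (blockMoment κ s 0 y * u + (blockMoment κ s 1 y + ρ * y) * v)
    - (blockMoment κ s 0 y * u ^ 2 + 2 * blockMoment κ s 1 y * u * v
      + (blockMoment κ s 2 y + ρ * y) * v ^ 2) / 2

/-- The remainder of the second order Taylor expansion of the exponential function. -/
noncomputable def expRemainder (w : ℂ) : ℂ := Complex.exp w - 1 - w - w ^ 2 / 2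

theorem norm_expRemainder_le (w : ℂ) : ‖expRemainder w‖ ≤ ‖w‖ ^ 3 * Real.exp ‖w‖ := by
  have h := Complex.norm_exp_sub_sum_le_norm_mul_exp w 3
  convert! h using 2
  simp [expRemainder, sum_range_succ]
  ring

/-- The exponent is a superposition of the exponentials `exp(u + v j)` and `exp v`, so its Taylor
remainder is the same superposition of one-variable remainders and can be estimated termwise. -/
theorem hasSum_expRemainder (κ ρ : ℝ) (s : ℕ) (y : ℝ) (u v : ℂ) :
    HasSum (fun j => (blockWeight κ s y j : ℂ) * expRemainder (u + v * j))
      (gfRemainder κ ρ s y u v - ρ * y * expRemainder v) := by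
  have hm : ∀ i ≤ 2, HasSum (fun j => (blockWeight κ s y j : ℂ) * (j : ℂ) ^ i)
      (blockMoment κ s i y : ℂ) := fun i hi => by
    simpa using Complex.hasSum_ofReal.2 (hasSum_blockWeight_mul_pow κ s i hi y)
  have h := hasSum_blockWeight_mul_cexp κ s y u v
  have h0 := hasSum_blockWeight_mul_cexp κ s y 0 0
  simp only [Complex.exp_zero, one_mul, mul_one] at h0
  -- The quadratic polynomial in `u + v j` is sorted by powers of `j`, each power producing one
  -- moment.
  have H := (((h.sub h0).sub ((hm 0 (by norm_num)).mul_left (u + u ^ 2 / 2))).sub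
    ((hm 1 (by norm_num)).mul_left (v + u * v))).sub ((hm 2 le_rfl).mul_left (v ^ 2 / 2))
  convert! H using 1
  · ext j
    rw [expRemainder]
    simp only [zero_mul, add_zero, Complex.exp_zero]
    ring
  · rw [gfRemainder, gfExponent, gfExponent, expRemainder]
    ring

/-! ### Cauchy's coefficient integral -/

theorem integral_exp_int_mul_I (k n : ℕ) :
    ∫ θ in -Real.pi..Real.pi, Complex.exp (((k : ℂ) - n) * (θ * Complex.I)) =
      if k = n then (2 * Real.pi : ℂ) else 0 := by
  split_ifs with h
  · subst h
    simp
    ring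
  · have hc : ((k : ℂ) - n) * Complex.I ≠ 0 := by
      refine mul_ne_zero (sub_ne_zero.2 (by exact_mod_cast h)) Complex.I_ne_zero
    have h1 : ∀ θ : ℝ, ((k : ℂ) - n) * (θ * Complex.I) = ((k : ℂ) - n) * Complex.I * θ := fun θ => by
      ring
    simp only [h1]
    rw [integral_exp_mul_complex hc]
    have h2 : Complex.exp (((k : ℂ) - n) * Complex.I * (Real.pi : ℝ)) =
        Complex.exp (((k : ℂ) - n) * Complex.I * ((-Real.pi : ℝ) : ℂ)) := by
      rw [Complex.exp_eq_exp_iff_exists_int]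
      refine ⟨(k : ℤ) - n, ?_⟩
      push_cast
      ring
    rw [h2, sub_self, zero_div]

/-- Termwise integration and orthogonality of the characters. The complex shift `v` is allowed
because it rescales and rotates the circle without changing the coefficient; it is later used to
remove the cross term. -/
theorem coeff_mul_pow_eq_integral {a : ℕ → ℂ} {F : ℂ → ℂ}
    (h : ∀ w, HasSum (fun k => a k * w ^ k) (F w)) (n : ℕ) (y v : ℂ) :
    ∫ θ in -Real.pi..Real.pi, F (y * Complex.exp (v + θ * Complex.I)) *
      Complex.exp (-(n * (v + θ * Complex.I))) = 2 * Real.pi * (a n * y ^ n) := by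
  let f : ℕ → ℝ → ℂ := fun k θ => a k * y ^ k * Complex.exp (((k : ℂ) - n) * v) *
    Complex.exp (((k : ℂ) - n) * (θ * Complex.I))
  have hf : ∀ k (θ : ℝ), f k θ = a k * (y * Complex.exp (v + θ * Complex.I)) ^ k *
      Complex.exp (-(n * (v + θ * Complex.I))) := by
    intro k θ
    simp only [f]
    have e : Complex.exp (((k : ℂ) - n) * v) * Complex.exp (((k : ℂ) - n) * (θ * Complex.I)) =
        Complex.exp (k * (v + θ * Complex.I)) * Complex.exp (-(n * (v + θ * Complex.I))) := by
      rw [← Complex.exp_add, ← Complex.exp_add]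
      congr 1
      ring
    rw [mul_pow, ← Complex.exp_nat_mul]
    linear_combination (a k * y ^ k) * e
  have hs : Summable (fun k => ‖a k * (y * Complex.exp v) ^ k‖ * ‖Complex.exp (-(n * v))‖) :=
    ((h (y * Complex.exp v)).summable.norm).mul_right _
  have hnorm : ∀ k (θ : ℝ), ‖f k θ‖ =
      ‖a k * (y * Complex.exp v) ^ k‖ * ‖Complex.exp (-(n * v))‖ := by
    intro k θ
    rw [hf]
    simp only [norm_mul, norm_pow, Complex.norm_exp]
    simp
  have hsum := intervalIntegral.hasSum_integral_of_dominated_convergence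
    (a := -Real.pi) (b := Real.pi) (μ := volume) (F := f)
    (f := fun θ : ℝ => F (y * Complex.exp (v + θ * Complex.I)) *
      Complex.exp (-(n * (v + θ * Complex.I))))
    (fun k _ => ‖a k * (y * Complex.exp v) ^ k‖ * ‖Complex.exp (-(n * v))‖)
    (fun k => (by fun_prop : Continuous (f k)).aestronglyMeasurable)
    (fun k => ae_of_all _ fun θ _ => (hnorm k θ).le)
    (ae_of_all _ fun θ _ => hs) intervalIntegrable_const
    (ae_of_all _ fun θ _ => by
      simp only [hf]
      exact (h _).mul_right _)
  refine hsum.unique ?_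
  have h3 : ∀ k, ∫ θ in -Real.pi..Real.pi, f k θ =
      if k = n then 2 * Real.pi * (a n * y ^ n) else 0 := by
    intro k
    simp only [f]
    rw [intervalIntegral.integral_const_mul, integral_exp_int_mul_I]
    split_ifs with hk
    · subst hk
      simp
      ring
    · simp
  simp only [h3]
  exact hasSum_ite_eq n _

/-! ### Uniform bound for the Taylor remainder -/

/-- Each term is cubic in `δ = 2 exp(-2y/5)`, giving `exp(-6y/5)`, while the total mass of the
weights is about `exp y`. A little of the gap is spent on the factors `(1 + j)^3` and `exp(δ j)`. -/
theorem exists_norm_gfRemainder_le {κ ρ : ℝ} (hκ : 0 ≤ κ) (hρ : 0 ≤ ρ) (s : ℕ) :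
    ∃ C, 0 ≤ C ∧ ∀ᶠ y : ℝ in atTop, ∀ u v : ℂ, ‖u‖ ≤ 2 * Real.exp (-(2 / 5) * y) →
      ‖v‖ ≤ 2 * Real.exp (-(2 / 5) * y) →
      ‖gfRemainder κ ρ s y u v‖ ≤ C * Real.exp (-(1 / 20) * y) := by
  -- The cube is absorbed by `(11/10)^j` and, below, `exp(δ j)` by `(23/22)^j`. Since `11/10 * 23/22
  -- = 23/20 < 6/5`, the series sums to `exp(23y/20)` and leaves the decay `exp(-y/20)`.
  obtain ⟨C₁, hC₁⟩ := (tendsto_pow_const_div_const_pow_of_one_lt 3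
    (by norm_num : (1 : ℝ) < 11 / 10)).bddAbove_range
  have hC : ∀ j : ℕ, (1 + (j : ℝ)) ^ 3 ≤ (11 / 10 * max C₁ 0) * (11 / 10) ^ j := by
    intro j
    have h := (hC₁ ⟨j + 1, rfl⟩).trans (le_max_left C₁ 0)
    rw [div_le_iff₀ (by positivity)] at h
    push_cast at h
    calc (1 + (j : ℝ)) ^ 3 = ((j : ℝ) + 1) ^ 3 := by ring
      _ ≤ _ := h
      _ = _ := by ring
  set C₀ := 11 / 10 * max C₁ 0 with hC₀
  have hC₀' : 0 ≤ C₀ := by positivity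
  refine ⟨8 * (C₀ * (23 / 22) * κ) + ρ * (8 * (23 / 22)), by positivity, ?_⟩
  have hδ : Tendsto (fun y : ℝ => 2 * Real.exp (-(2 / 5) * y)) atTop (𝓝 0) := by
    have : Tendsto (fun y : ℝ => -(2 / 5) * y) atTop atBot :=
      tendsto_id.const_mul_atTop_of_neg (by norm_num)
    simpa using (Real.tendsto_exp_atBot.comp this).const_mul 2
  have hδ' : Tendsto (fun y : ℝ => Real.exp (2 * Real.exp (-(2 / 5) * y))) atTop (𝓝 1) := by
    simpa [Function.comp_def] using (Real.continuous_exp.tendsto 0).comp hδ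
  filter_upwards [hδ'.eventually_le_const (by norm_num : (1 : ℝ) < 23 / 22), eventually_ge_atTop 0]
    with y hy hy0 u v hu hv
  set δ := 2 * Real.exp (-(2 / 5) * y) with hδdef
  have hδ0 : 0 ≤ δ := by positivity
  have hR : ∀ t : ℝ, 0 ≤ t → ∀ w : ℂ, ‖w‖ ≤ t → ‖expRemainder w‖ ≤ t ^ 3 * Real.exp t := by
    intro t ht w hw
    refine (norm_expRemainder_le w).trans ?_
    gcongr
  have hδ3 : δ ^ 3 = 8 * Real.exp (-(6 / 5) * y) := by
    rw [hδdef, mul_pow, ← Real.exp_nat_mul]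
    norm_num
    ring_nf
  have hE : HasSum (fun j : ℕ => (C₀ * (23 / 22) * κ * δ ^ 3) * ((23 / 20 * y) ^ j / j.factorial))
      ((C₀ * (23 / 22) * κ * δ ^ 3) * Real.exp (23 / 20 * y)) := by
    have := (hasSum_pow_div_factorial_zero (23 / 20 * y)).mul_left (C₀ * (23 / 22) * κ * δ ^ 3)
    simpa using this
  have h1 := (hasSum_expRemainder κ ρ s y u v).norm_le_of_bounded hE (fun j => by
    have hw : ‖u + v * j‖ ≤ δ * (1 + j) := by
      calc ‖u + v * j‖ ≤ ‖u‖ + ‖v * j‖ := norm_add_le _ _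
        _ = ‖u‖ + ‖v‖ * j := by simp
        _ ≤ δ + δ * j := by gcongr
        _ = _ := by ring
    have hbw : blockWeight κ s y j ≤ κ * (y ^ j / j.factorial) := by
      unfold blockWeight
      split_ifs
      · exact le_rfl
      · positivity
    have hexp : Real.exp (δ * (1 + j)) ≤ 23 / 22 * (23 / 22) ^ j := by
      have : δ * (1 + j) = δ + j * δ := by ring
      rw [this, Real.exp_add, Real.exp_nat_mul]
      gcongr
    rw [norm_mul, Complex.norm_real, Real.norm_of_nonneg (blockWeight_nonneg hκ s hy0 j)]
    calc blockWeight κ s y j * ‖expRemainder (u + v * j)‖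
        ≤ (κ * (y ^ j / j.factorial)) * ((δ * (1 + j)) ^ 3 * Real.exp (δ * (1 + j))) :=
          mul_le_mul hbw (hR _ (by positivity) _ hw) (norm_nonneg _) (by positivity)
      _ ≤ (κ * (y ^ j / j.factorial)) * (δ ^ 3 * (C₀ * (11 / 10) ^ j) *
          (23 / 22 * (23 / 22) ^ j)) := by
          rw [mul_pow]
          have := hC j
          gcongr
      _ = _ := by
          have : (23 / 20 * y) ^ j = (11 / 10) ^ j * (23 / 22) ^ j * y ^ j := by
            rw [← mul_pow, ← mul_pow]; norm_num
          rw [this]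
          ring)
  have h2 : ‖(ρ : ℂ) * y * expRemainder v‖ ≤ ρ * y * (δ ^ 3 * (23 / 22)) := by
    rw [norm_mul, norm_mul, Complex.norm_real, Complex.norm_real, Real.norm_of_nonneg hρ,
      Real.norm_of_nonneg hy0]
    have := hR δ hδ0 v hv
    gcongr
    exact this.trans (by gcongr)
  have h3 : ‖gfRemainder κ ρ s y u v‖ ≤ (C₀ * (23 / 22) * κ * δ ^ 3) * Real.exp (23 / 20 * y) +
      ρ * y * (δ ^ 3 * (23 / 22)) := by
    have := norm_add_le (gfRemainder κ ρ s y u v - ρ * y * expRemainder v)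
      ((ρ : ℂ) * y * expRemainder v)
    rw [sub_add_cancel] at this
    linarith
  refine h3.trans ?_
  have e1 : Real.exp (-(6 / 5) * y) * Real.exp (23 / 20 * y) = Real.exp (-(1 / 20) * y) := by
    rw [← Real.exp_add]; ring_nf
  have e2 : y * Real.exp (-(6 / 5) * y) ≤ Real.exp (-(1 / 20) * y) := by
    rw [← e1, mul_comm]
    gcongr
    linarith [Real.add_one_le_exp (23 / 20 * y)]
  calc _ = 8 * (C₀ * (23 / 22) * κ) * (Real.exp (-(6 / 5) * y) * Real.exp (23 / 20 * y)) +
        ρ * (8 * (23 / 22)) * (y * Real.exp (-(6 / 5) * y)) := by rw [hδ3]; ring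
    _ ≤ 8 * (C₀ * (23 / 22) * κ) * Real.exp (-(1 / 20) * y) +
        ρ * (8 * (23 / 22)) * Real.exp (-(1 / 20) * y) := by
        rw [e1]; gcongr
    _ = _ := by ring

/-! ### Completing the square and decay away from the saddle -/

theorem momentHead_nonneg (s i : ℕ) {y : ℝ} (hy : 0 ≤ y) : 0 ≤ momentHead s i y :=
  sum_nonneg fun j _ => by positivity

/-- The omitted small blocks contribute only a polynomial in `y`, negligible against any
exponential. -/
theorem exists_momentHead_le (s i : ℕ) {δ : ℝ} (hδ : 0 < δ) :
    ∃ C, 0 ≤ C ∧ ∀ y, 0 ≤ y → momentHead s i y ≤ C * Real.exp (δ * y) := by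
  refine ⟨∑ j ∈ range s, (δ ^ j)⁻¹ * (j : ℝ) ^ i, sum_nonneg fun j _ => by positivity, ?_⟩
  intro y hy
  rw [momentHead, sum_mul]
  refine sum_le_sum fun j _ => ?_
  have h := Real.pow_div_factorial_le_exp (δ * y) (by positivity) j
  calc y ^ j / j.factorial * (j : ℝ) ^ i = (δ ^ j)⁻¹ * (j : ℝ) ^ i * ((δ * y) ^ j / j.factorial) := by
        rw [mul_pow]; field_simp
    _ ≤ _ := by gcongr

theorem blockMoment_nonneg {κ : ℝ} (hκ : 0 ≤ κ) (s i : ℕ) (hi : i ≤ 2) {y : ℝ} (hy : 0 ≤ y) :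
    0 ≤ blockMoment κ s i y :=
  (hasSum_blockWeight_mul_pow κ s i hi y).nonneg fun j =>
    mul_nonneg (blockWeight_nonneg hκ s hy j) (by positivity)

theorem blockMoment_one_le_two {κ : ℝ} (hκ : 0 ≤ κ) (s : ℕ) {y : ℝ} (hy : 0 ≤ y) :
    blockMoment κ s 1 y ≤ blockMoment κ s 2 y := by
  refine hasSum_le (fun j => ?_) (hasSum_blockWeight_mul_pow κ s 1 (by norm_num) y)
    (hasSum_blockWeight_mul_pow κ s 2 le_rfl y)
  refine mul_le_mul_of_nonneg_left ?_ (blockWeight_nonneg hκ s hy j)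
  rcases j.eq_zero_or_pos with rfl | hj
  · simp
  · exact pow_le_pow_right₀ (by exact_mod_cast hj) (by norm_num)

/-- The variance of the total size, in the grand canonical model with parameter `y`. -/
noncomputable def sizeVariance (κ ρ : ℝ) (s : ℕ) (y : ℝ) : ℝ := blockMoment κ s 2 y + ρ * y

/-- The regression coefficient of the number of blocks on the total size. -/
noncomputable def regressionSlope (κ ρ : ℝ) (s : ℕ) (y : ℝ) : ℝ :=
  blockMoment κ s 1 y / sizeVariance κ ρ s y

/-- The residual variance of the number of blocks after regression on the total size. -/
noncomputable def residualVariance (κ ρ : ℝ) (s : ℕ) (y : ℝ) : ℝ :=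
  blockMoment κ s 0 y - blockMoment κ s 1 y ^ 2 / sizeVariance κ ρ s y

theorem tendsto_exp_neg_mul {δ : ℝ} (hδ : 0 < δ) :
    Tendsto (fun y : ℝ => Real.exp (-δ * y)) atTop (𝓝 0) :=
  Real.tendsto_exp_atBot.comp (tendsto_id.const_mul_atTop_of_neg (by linarith))

theorem tendsto_exp_mul {δ : ℝ} (hδ : 0 < δ) :
    Tendsto (fun y : ℝ => Real.exp (δ * y)) atTop atTop :=
  Real.tendsto_exp_atTop.comp (tendsto_id.const_mul_atTop hδ)

theorem eventually_le_sizeVariance {κ ρ : ℝ} (hκ : 0 < κ) (hρ : 0 ≤ ρ) (s : ℕ) :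
    ∀ᶠ y in atTop, κ * Real.exp y ≤ sizeVariance κ ρ s y := by
  obtain ⟨C, hC, h⟩ := exists_momentHead_le s 2 (δ := 1 / 2) (by norm_num)
  filter_upwards [(tendsto_exp_mul (δ := 1 / 2) (by norm_num)).eventually_ge_atTop C,
    eventually_ge_atTop 1] with y hy hy1
  have h1 := h y (by linarith)
  have h2 : C * Real.exp (1 / 2 * y) ≤ Real.exp y := by
    calc _ ≤ Real.exp (1 / 2 * y) * Real.exp (1 / 2 * y) := by gcongr
      _ = _ := by rw [← Real.exp_add]; ring_nf
  have h3 : 2 * Real.exp y ≤ (y ^ 2 + y) * Real.exp y := by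
    gcongr
    nlinarith
  rw [sizeVariance, blockMoment_two]
  have : κ * Real.exp y ≤ κ * ((y ^ 2 + y) * Real.exp y - momentHead s 2 y) := by
    gcongr
    linarith
  nlinarith [mul_nonneg hρ (by linarith : 0 ≤ y)]

theorem sizeVariance_le {κ ρ : ℝ} (hκ : 0 ≤ κ) (hρ : 0 ≤ ρ) (s : ℕ) {y : ℝ} (hy : 0 ≤ y) :
    sizeVariance κ ρ s y ≤ (2 * κ + ρ) * Real.exp (3 * y) := by
  have h0 := momentHead_nonneg s 2 hy
  have h1 : y ≤ Real.exp y := by linarith [Real.add_one_le_exp y]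
  have e3 : Real.exp (3 * y) = Real.exp y ^ 3 := by rw [← Real.exp_nat_mul]; norm_num
  have h2 : 1 ≤ Real.exp y := Real.one_le_exp hy
  have h3 : (y ^ 2 + y) * Real.exp y ≤ 2 * Real.exp (3 * y) := by
    have : y ^ 2 + y ≤ 2 * Real.exp y ^ 2 := by nlinarith
    calc _ ≤ 2 * Real.exp y ^ 2 * Real.exp y := by gcongr
      _ = _ := by rw [e3]; ring
  have h4 : y ≤ Real.exp (3 * y) := h1.trans (Real.exp_le_exp.2 (by linarith))
  rw [sizeVariance, blockMoment_two]
  calc _ ≤ κ * (2 * Real.exp (3 * y)) + ρ * Real.exp (3 * y) := by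
        gcongr
        linarith
    _ = _ := by ring

/-- Completing the square: along `v = -c u + iθ` with `c = M_1/b`, `b` the size variance, the form
`M_0 u² + 2 M_1 u v + b v²` becomes `(M_0 - M_1²/b) u² - b θ²`. -/
theorem gfExponent_sub_eq {κ ρ : ℝ} {s : ℕ} {y : ℝ} (hb : sizeVariance κ ρ s y ≠ 0) (u : ℂ) (θ : ℝ) :
    gfExponent κ ρ s (Complex.exp u)
        (y * Complex.exp (-(regressionSlope κ ρ s y * u) + θ * Complex.I))
      - gfExponent κ ρ s 1 y
      - (blockMoment κ s 1 y + ρ * y) * (-(regressionSlope κ ρ s y * u) + θ * Complex.I)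
      - blockMoment κ s 0 y * u - residualVariance κ ρ s y * u ^ 2 / 2 =
    -(sizeVariance κ ρ s y * θ ^ 2 / 2) +
      gfRemainder κ ρ s y u (-(regressionSlope κ ρ s y * u) + θ * Complex.I) := by
  have hc : (regressionSlope κ ρ s y : ℂ) * sizeVariance κ ρ s y = blockMoment κ s 1 y := by
    rw [← Complex.ofReal_mul, regressionSlope, div_mul_cancel₀ _ hb]
  have hσ : (residualVariance κ ρ s y : ℂ) = blockMoment κ s 0 y -
      blockMoment κ s 1 y * regressionSlope κ ρ s y := by
    rw [← Complex.ofReal_mul, ← Complex.ofReal_sub, residualVariance, regressionSlope]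
    congr 1
    ring
  have hb2 : (blockMoment κ s 2 y : ℂ) + ρ * y = sizeVariance κ ρ s y := by
    rw [sizeVariance]; push_cast; ring
  rw [gfRemainder, hb2, hσ]
  set c : ℂ := (regressionSlope κ ρ s y : ℂ)
  set b : ℂ := (sizeVariance κ ρ s y : ℂ)
  rw [← hc]
  linear_combination (b * (θ : ℂ) ^ 2 / 2) * Complex.I_sq

/-- The bound `cos θ ≤ 1 - 2θ²/π² ≤ 1 - θ²/5` has enough room to absorb a perturbation that is small
relative to `θ`. The perturbation arises because a complex `u` rotates the contour. -/
theorem cos_sub_le {θ ε : ℝ} (hθ : |θ| ≤ Real.pi) (hε : |ε| ≤ |θ| / 20) :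
    Real.cos (θ - ε) ≤ 1 - θ ^ 2 / 10 := by
  have h1 := Real.cos_le_one_sub_mul_cos_sq hθ
  have h2 := Real.one_sub_sq_div_two_le_cos (x := ε)
  have h3 : Real.sin θ * Real.sin ε ≤ |θ| * |ε| := by
    calc _ ≤ |Real.sin θ * Real.sin ε| := le_abs_self _
      _ = |Real.sin θ| * |Real.sin ε| := abs_mul _ _
      _ ≤ _ := mul_le_mul Real.abs_sin_le_abs Real.abs_sin_le_abs (abs_nonneg _) (abs_nonneg _)
  have h4 : (0.2 : ℝ) ≤ 2 / Real.pi ^ 2 := by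
    rw [le_div_iff₀ (by positivity)]
    nlinarith [Real.pi_lt_d2, Real.pi_pos]
  have h5 : |θ| * |ε| ≤ θ ^ 2 / 20 := by
    have := mul_le_mul_of_nonneg_left hε (abs_nonneg θ)
    have := sq_abs θ
    nlinarith
  have h6 : ε ^ 2 ≤ θ ^ 2 / 400 := by
    rw [← sq_abs ε, ← sq_abs θ]
    nlinarith [abs_nonneg ε, abs_nonneg θ]
  have h7 : Real.cos θ * Real.cos ε ≤ Real.cos θ + ε ^ 2 / 2 := by
    have := Real.cos_le_one ε
    have := Real.neg_one_le_cos θ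
    nlinarith
  rw [Real.cos_sub]
  nlinarith [sq_nonneg θ]

theorem norm_sum_pow_div_factorial_le (s : ℕ) (w : ℂ) :
    ‖∑ j ∈ range s, w ^ j / (j.factorial : ℂ)‖ ≤ momentHead s 0 ‖w‖ := by
  refine (norm_sum_le _ _).trans_eq (sum_congr rfl fun j _ => ?_)
  simp

theorem re_gfExponent_le {κ ρ : ℝ} (hκ : 0 ≤ κ) (hρ : 0 ≤ ρ) (s : ℕ) (u w : ℂ) :
    (gfExponent κ ρ s (Complex.exp u) w).re ≤
      ρ * ‖w‖ + κ * Real.exp u.re * (Real.exp w.re + momentHead s 0 ‖w‖) := by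
  refine (Complex.re_le_norm _).trans ?_
  rw [gfExponent]
  refine (norm_add_le _ _).trans ?_
  rw [norm_mul, norm_mul, norm_mul, Complex.norm_exp, Complex.norm_real, Complex.norm_real,
    Real.norm_of_nonneg hκ, Real.norm_of_nonneg hρ, mul_comm (Real.exp u.re) κ]
  gcongr
  refine (norm_sub_le _ _).trans ?_
  rw [Complex.norm_exp]
  gcongr
  exact norm_sum_pow_div_factorial_le s w

theorem re_gfExponent_ofReal (κ ρ : ℝ) (s : ℕ) (a Y : ℝ) :
    (gfExponent κ ρ s (Complex.exp a) Y).re =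
      ρ * Y + κ * Real.exp a * (Real.exp Y - momentHead s 0 Y) := by
  have : gfExponent κ ρ s (Complex.exp a) Y =
      ((ρ * Y + κ * Real.exp a * (Real.exp Y - momentHead s 0 Y) : ℝ) : ℂ) := by
    rw [gfExponent, momentHead]
    push_cast
    simp only [pow_zero, mul_one]
    ring
  rw [this, Complex.ofReal_re]

theorem regressionSlope_mem_Icc {κ ρ : ℝ} (hκ : 0 ≤ κ) (hρ : 0 ≤ ρ) (s : ℕ) {y : ℝ} (hy : 0 ≤ y) :
    regressionSlope κ ρ s y ∈ Set.Icc 0 1 := by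
  have h1 := blockMoment_nonneg hκ s 1 (by norm_num) hy
  have h2 := blockMoment_one_le_two hκ s hy
  have h3 : blockMoment κ s 2 y ≤ sizeVariance κ ρ s y := by
    rw [sizeVariance]; linarith [mul_nonneg hρ hy]
  exact ⟨div_nonneg h1 (h1.trans (h2.trans h3)), div_le_one_of_le₀ (h2.trans h3) (h1.trans (h2.trans h3))⟩

theorem residualVariance_le {κ ρ : ℝ} (hκ : 0 ≤ κ) (hρ : 0 ≤ ρ) (s : ℕ) {y : ℝ} (hy : 0 ≤ y) :
    residualVariance κ ρ s y ≤ κ * Real.exp y := by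
  have h1 : 0 ≤ sizeVariance κ ρ s y :=
    add_nonneg (blockMoment_nonneg hκ s 2 le_rfl hy) (mul_nonneg hρ hy)
  have h2 : 0 ≤ blockMoment κ s 1 y ^ 2 / sizeVariance κ ρ s y := by positivity
  rw [residualVariance, blockMoment_zero]
  nlinarith [mul_nonneg hκ (momentHead_nonneg s 0 hy)]

/-- The quadratic expansion is useless for large `θ`, so the exact exponent is compared with its
value at `(u.re, 0)`. Both contour points have modulus `Y`; the linear terms have equal real parts,
the squares of `u` differ by `u.im ^ 2`, and only the remainder at the real point, which is small,
survives. -/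
theorem re_exponent_le {κ ρ : ℝ} (hκ : 0 ≤ κ) (hρ : 0 ≤ ρ) (s : ℕ) {y : ℝ} (hy : 0 ≤ y)
    (hb : sizeVariance κ ρ s y ≠ 0) (u : ℂ) (θ : ℝ) {Y : ℝ}
    (hY : Y = y * Real.exp (-(regressionSlope κ ρ s y * u.re))) :
    (-(sizeVariance κ ρ s y * θ ^ 2 / 2) +
      gfRemainder κ ρ s y u (-(regressionSlope κ ρ s y * u) + θ * Complex.I)).re ≤
    κ * Real.exp u.re * (Real.exp (Y * Real.cos (θ - regressionSlope κ ρ s y * u.im)) - Real.exp Y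
      + 2 * momentHead s 0 Y) + residualVariance κ ρ s y * u.im ^ 2 / 2 +
      ‖gfRemainder κ ρ s y u.re (-(regressionSlope κ ρ s y * u.re))‖ := by
  have h1 := congrArg Complex.re (gfExponent_sub_eq hb u θ)
  have h2 := congrArg Complex.re (gfExponent_sub_eq hb (u.re : ℂ) 0)
  have hR := Complex.re_le_norm (gfRemainder κ ρ s y u.re (-(regressionSlope κ ρ s y * u.re)))
  rw [← h1]
  have hw : ‖(y : ℂ) * Complex.exp (-(regressionSlope κ ρ s y * u) + θ * Complex.I)‖ = Y := by
    rw [norm_mul, Complex.norm_exp, Complex.norm_real, Real.norm_of_nonneg hy, hY]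
    simp
  have hwr : ((y : ℂ) * Complex.exp (-(regressionSlope κ ρ s y * u) + θ * Complex.I)).re =
      Y * Real.cos (θ - regressionSlope κ ρ s y * u.im) := by
    rw [Complex.re_ofReal_mul, Complex.exp_re, hY, mul_assoc]
    congr 3
    · simp
    · simp; ring
  have h3 := re_gfExponent_le hκ hρ s u
    ((y : ℂ) * Complex.exp (-(regressionSlope κ ρ s y * u) + θ * Complex.I))
  rw [hw, hwr] at h3
  have h4 := re_gfExponent_ofReal κ ρ s u.re Y
  have hYc : (y : ℂ) * Complex.exp (-(regressionSlope κ ρ s y * (u.re : ℂ)) +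
      ((0 : ℝ) : ℂ) * Complex.I) = (Y : ℂ) := by
    rw [hY]; push_cast; simp
  rw [hYc] at h2
  simp only [Complex.ofReal_zero, zero_mul, add_zero, ne_eq, OfNat.ofNat_ne_zero, not_false_eq_true,
    zero_pow, mul_zero, zero_div, neg_zero, zero_add] at h2
  have e1 : ((blockMoment κ s 1 y + ρ * y : ℂ) *
      (-(regressionSlope κ ρ s y * u) + θ * Complex.I)).re =
      ((blockMoment κ s 1 y + ρ * y : ℂ) * (-(regressionSlope κ ρ s y * (u.re : ℂ)))).re := by
    rw [← Complex.ofReal_mul, ← Complex.ofReal_add, Complex.re_ofReal_mul, Complex.re_ofReal_mul]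
    simp
  have e2 : ((blockMoment κ s 0 y : ℂ) * u).re = ((blockMoment κ s 0 y : ℂ) * (u.re : ℂ)).re := by
    rw [Complex.re_ofReal_mul, Complex.re_ofReal_mul, Complex.ofReal_re]
  have e3 : ((residualVariance κ ρ s y : ℂ) * u ^ 2 / 2).re =
      ((residualVariance κ ρ s y : ℂ) * (u.re : ℂ) ^ 2 / 2).re -
        residualVariance κ ρ s y * u.im ^ 2 / 2 := by
    rw [mul_div_assoc, mul_div_assoc, Complex.re_ofReal_mul, Complex.re_ofReal_mul]
    have : ∀ z : ℂ, (z / 2).re = z.re / 2 := fun z => by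
      simp
    rw [this, this, pow_two, pow_two, Complex.mul_re, Complex.mul_re]
    simp
    ring
  simp only [Complex.sub_re] at h2 ⊢
  rw [e1, e2, e3]
  rw [h4] at h2
  linarith

theorem exp_mul_le_of_le_one_sub {Y x q : ℝ} (hY : 1 ≤ Y) (hq0 : 0 < q) (hq1 : q ≤ 1)
    (hx : x ≤ 1 - q / 10) : Real.exp (Y * x) ≤ Real.exp Y * (1 - q / 20) := by
  -- With `a = q/10 ≤ 1`, the estimate `exp(-a) ≤ 1 - a + a²` yields the factor `1 - q/20`.
  have h1 : Y * x ≤ Y + -(q / 10) := by nlinarith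
  refine (Real.exp_le_exp.2 h1).trans ?_
  rw [Real.exp_add]
  gcongr
  have h5 := Real.abs_exp_sub_one_sub_id_le (x := -(q / 10))
    (by rw [abs_neg, abs_of_nonneg (by positivity)]; linarith)
  have := (abs_le.1 h5).2
  nlinarith

-- With `E = exp(y/10)`, the loss of `Re exp w` on the far arc is at least of order `exp(y) θ² ≥
-- exp(y/5) = E²`. The head, the term in `u.im ^ 2` and the remainder are all `O(E)`, so the
-- quadratic gain wins.
set_option maxHeartbeats 400000 in
theorem eventually_re_exponent_le {κ ρ : ℝ} (hκ : 0 < κ) (hρ : 0 ≤ ρ) (s : ℕ) :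
    ∀ᶠ y : ℝ in atTop, ∀ u : ℂ, ‖u‖ ≤ Real.exp (-(9 / 20) * y) → ∀ θ : ℝ,
      Real.exp (-(2 / 5) * y) ≤ |θ| → |θ| ≤ Real.pi →
      (-(sizeVariance κ ρ s y * θ ^ 2 / 2) +
        gfRemainder κ ρ s y u (-(regressionSlope κ ρ s y * u) + θ * Complex.I)).re ≤
      -Real.exp (1 / 10 * y) := by
  obtain ⟨C, hC, hrem⟩ := exists_norm_gfRemainder_le hκ.le hρ s
  obtain ⟨D, hD, hhead⟩ := exists_momentHead_le s 0 (δ := 1 / 10) (by norm_num)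
  have hu20 : ∀ᶠ y in atTop, Real.exp (-(1 / 20) * y) ≤ 1 / 20 :=
    (tendsto_exp_neg_mul (by norm_num)).eventually_le_const (by norm_num)
  -- `K` collects the coefficients of all `O(E)` errors, with an extra 1 for the bound `-E` to be
  -- proved.
  set K := 3 * κ * (2 * D * 3) + κ + C + 1 with hK
  have hbig : ∀ᶠ y : ℝ in atTop, K ≤ κ / 200 * Real.exp (1 / 10 * y) :=
    ((tendsto_exp_mul (by norm_num)).const_mul_atTop (by positivity)).eventually_ge_atTop K
  filter_upwards [hrem, hu20, hbig, eventually_ge_atTop 2, eventually_le_sizeVariance hκ hρ s]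
    with y hrem hu20 hbig hy2 hbκ u hu θ hθ1 hθ2
  have hy0 : 0 ≤ y := by linarith
  have hb : sizeVariance κ ρ s y ≠ 0 := by
    have : 0 < κ * Real.exp y := by positivity
    linarith
  obtain ⟨hc0, hc1⟩ := regressionSlope_mem_Icc hκ.le hρ s hy0
  set c := regressionSlope κ ρ s y with hcdef
  have h := re_exponent_le hκ.le hρ s hy0 hb u θ rfl
  set Y := y * Real.exp (-(c * u.re)) with hYdef
  refine h.trans ?_
  have hua : |u.re| ≤ Real.exp (-(9 / 20) * y) := (Complex.abs_re_le_norm u).trans hu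
  have hub : |u.im| ≤ Real.exp (-(9 / 20) * y) := (Complex.abs_im_le_norm u).trans hu
  -- Because `9/20 > 2/5`, the rotation caused by `u` is at most a twentieth of every `|θ|` beyond
  -- the cutoff.
  have hsmall : Real.exp (-(9 / 20) * y) ≤ Real.exp (-(2 / 5) * y) / 20 := by
    have : Real.exp (-(9 / 20) * y) = Real.exp (-(2 / 5) * y) * Real.exp (-(1 / 20) * y) := by
      rw [← Real.exp_add]; ring_nf
    rw [this]
    have := mul_le_mul_of_nonneg_left hu20 (Real.exp_pos (-(2 / 5) * y)).le
    linarith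
  have hθ0le : Real.exp (-(2 / 5) * y) ≤ 1 := Real.exp_le_one_iff.2 (by linarith)
  have hyu : y * Real.exp (-(9 / 20) * y) ≤ 1 := by
    have h1 := Real.quadratic_le_exp_of_nonneg (x := 9 / 20 * y) (by positivity)
    have h2 : y ≤ Real.exp (9 / 20 * y) := by nlinarith [sq_nonneg (y - 3)]
    calc _ ≤ Real.exp (9 / 20 * y) * Real.exp (-(9 / 20) * y) := by gcongr
      _ = 1 := by rw [← Real.exp_add]; simp
  have hcu : |c * u.re| ≤ Real.exp (-(9 / 20) * y) := by
    rw [abs_mul, abs_of_nonneg hc0]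
    exact (mul_le_of_le_one_left (abs_nonneg _) hc1).trans hua
  have hcub : |c * u.im| ≤ |θ| / 20 := by
    rw [abs_mul, abs_of_nonneg hc0]
    have := (mul_le_of_le_one_left (abs_nonneg u.im) hc1).trans hub
    linarith
  have hcos := cos_sub_le hθ2 hcub
  have hYlo : y - 1 ≤ Y := by
    have h1 := Real.add_one_le_exp (-(c * u.re))
    have h2 := (abs_le.1 hcu).2
    have : y * (1 - Real.exp (-(9 / 20) * y)) ≤ Y := by
      rw [hYdef]; gcongr; linarith
    linarith
  have hYhi' : Y ≤ y + 2 := by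
    have h1 := (abs_le.1 hcu).1
    set e := Real.exp (-(9 / 20) * y) with he
    have he0 : 0 < e := Real.exp_pos _
    have he1 : e ≤ 1 := by linarith
    have h2 : Real.exp (-(c * u.re)) ≤ 1 + 2 * e := by
      have h3 : Real.exp (-(c * u.re)) ≤ Real.exp e := Real.exp_le_exp.2 (by linarith)
      have h5 := (abs_le.1 (Real.abs_exp_sub_one_sub_id_le (x := e) (by rwa [abs_of_pos he0]))).2
      nlinarith
    have h4 : Y ≤ y * (1 + 2 * e) := by rw [hYdef]; gcongr
    linarith
  have hθsq : Real.exp (-(4 / 5) * y) ≤ θ ^ 2 := by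
    rw [← sq_abs θ]
    calc Real.exp (-(4 / 5) * y) = Real.exp (-(2 / 5) * y) ^ 2 := by
          rw [← Real.exp_nat_mul]; congr 1; push_cast; ring
      _ ≤ _ := by gcongr
  have hT : momentHead s 0 Y ≤ D * (3 * Real.exp (1 / 10 * y)) := by
    refine (hhead Y (by linarith)).trans ?_
    gcongr
    calc Real.exp (1 / 10 * Y) ≤ Real.exp (1 + 1 / 10 * y) := by
          apply Real.exp_le_exp.2; linarith
      _ = Real.exp 1 * Real.exp (1 / 10 * y) := Real.exp_add _ _
      _ ≤ _ := by
        gcongr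
        linarith [Real.exp_one_lt_d9]
  set q := Real.exp (-(4 / 5) * y) with hq
  have hq1 : q ≤ 1 := Real.exp_le_one_iff.2 (by linarith)
  have hq0 : 0 < q := Real.exp_pos _
  have hgain : Real.exp (Y * Real.cos (θ - c * u.im)) ≤ Real.exp Y * (1 - q / 20) :=
    exp_mul_le_of_le_one_sub (by linarith) hq0 hq1 (hcos.trans (by linarith))
  have hea : 1 / 3 ≤ Real.exp u.re ∧ Real.exp u.re ≤ 3 := by
    have h1 := abs_le.1 hua
    constructor
    · have : Real.exp (-1) ≤ Real.exp u.re := Real.exp_le_exp.2 (by linarith)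
      refine le_trans ?_ this
      rw [Real.exp_neg, ← one_div]
      apply one_div_le_one_div_of_le (Real.exp_pos 1)
      linarith [Real.exp_one_lt_d9]
    · have : Real.exp u.re ≤ Real.exp 1 := Real.exp_le_exp.2 (by linarith)
      linarith [Real.exp_one_lt_d9]
  have heY : Real.exp y / 3 ≤ Real.exp Y := by
    have : Real.exp (y - 1) ≤ Real.exp Y := Real.exp_le_exp.2 hYlo
    rw [Real.exp_sub] at this
    refine le_trans ?_ this
    gcongr
    linarith [Real.exp_one_lt_d9]
  set E := Real.exp (1 / 10 * y) with hE
  have hE1 : 1 ≤ E := Real.one_le_exp (by positivity)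
  have hEq : Real.exp y * q = E * E := by
    rw [hq, hE, ← Real.exp_add, ← Real.exp_add]; ring_nf
  have hvar : residualVariance κ ρ s y * u.im ^ 2 / 2 ≤ κ * E := by
    have h1 := residualVariance_le hκ.le hρ s hy0
    have h2 : u.im ^ 2 ≤ Real.exp (-(9 / 10) * y) := by
      rw [← sq_abs]
      calc _ ≤ Real.exp (-(9 / 20) * y) ^ 2 := by gcongr
        _ = _ := by rw [← Real.exp_nat_mul]; congr 1; push_cast; ring
    have h3 : Real.exp y * Real.exp (-(9 / 10) * y) = E := by
      rw [hE, ← Real.exp_add]; ring_nf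
    have h4 : residualVariance κ ρ s y * u.im ^ 2 ≤ κ * Real.exp y * u.im ^ 2 := by gcongr
    have h5 : κ * Real.exp y * u.im ^ 2 ≤ κ * Real.exp y * Real.exp (-(9 / 10) * y) := by gcongr
    have h6 : 0 ≤ κ * E := by positivity
    rw [mul_assoc κ _ (Real.exp (-(9 / 10) * y)), h3] at h5
    linarith
  have hrem' : ‖gfRemainder κ ρ s y u.re (-(c * u.re))‖ ≤ C * E := by
    refine (hrem _ _ ?_ ?_).trans ?_
    · rw [Complex.norm_real, Real.norm_eq_abs]
      have := Real.exp_pos (-(2 / 5) * y)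
      linarith
    · rw [norm_neg, ← Complex.ofReal_mul, Complex.norm_real, Real.norm_eq_abs]
      have := Real.exp_pos (-(2 / 5) * y)
      linarith
    · gcongr
      linarith
  have hmain : κ * Real.exp u.re * (Real.exp (Y * Real.cos (θ - c * u.im)) - Real.exp Y
      + 2 * momentHead s 0 Y) ≤ -(κ / 180 * (E * E)) + 3 * κ * (2 * D * 3) * E := by
    have h1 : Real.exp (Y * Real.cos (θ - c * u.im)) - Real.exp Y ≤ -(E * E / 60) := by
      have h2 : Real.exp y / 3 * (q / 20) ≤ Real.exp Y * (q / 20) := by gcongr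
      have h3 : Real.exp y / 3 * (q / 20) = E * E / 60 := by rw [← hEq]; ring
      have h4 : Real.exp Y * (1 - q / 20) = Real.exp Y - Real.exp Y * (q / 20) := by ring
      linarith
    calc _ ≤ κ * Real.exp u.re * (-(E * E / 60) + 2 * (D * (3 * E))) := by gcongr
      _ = -(κ * Real.exp u.re * (E * E / 60)) + κ * Real.exp u.re * (2 * (D * (3 * E))) := by ring
      _ ≤ -(κ * (1 / 3) * (E * E / 60)) + κ * 3 * (2 * (D * (3 * E))) := by
        gcongr
        · exact hea.1
        · exact hea.2
      _ = _ := by ring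
  have hfin : K * E ≤ κ / 200 * E * E := mul_le_mul_of_nonneg_right hbig (by positivity)
  have : κ / 200 * E * E ≤ κ / 180 * (E * E) := by
    have : 0 ≤ κ * (E * E) := by positivity
    linarith
  have hKE : K * E = 3 * κ * (2 * D * 3) * E + κ * E + C * E + E := by rw [hK]; ring
  linarith

/-! ### Laplace's method for the contour integral -/

/-- The exponent of the normalized integrand on the circle through the saddle point. -/
noncomputable def saddleExponent (κ ρ : ℝ) (s : ℕ) (y : ℝ) (u : ℂ) (θ : ℝ) : ℂ :=
  -(sizeVariance κ ρ s y * θ ^ 2 / 2) +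
    gfRemainder κ ρ s y u (-(regressionSlope κ ρ s y * u) + θ * Complex.I)

theorem continuous_saddleExponent (κ ρ : ℝ) (s : ℕ) (y : ℝ) (u : ℂ) :
    Continuous (saddleExponent κ ρ s y u) := by
  unfold saddleExponent gfRemainder gfExponent
  fun_prop

/-- The cutoff `|θ| = exp(-2y/5)` balances two demands: inside, the cubic remainder (about `exp(y)
|θ|³`) is small; outside, `exp(y) θ²` is large, so the integrand and its Gaussian model are each
negligible. -/
theorem exists_norm_exp_saddleExponent_sub_le {κ ρ : ℝ} (hκ : 0 < κ) (hρ : 0 ≤ ρ) (s : ℕ) :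
    ∃ C, 0 ≤ C ∧ ∀ᶠ y : ℝ in atTop, ∀ u : ℂ, ‖u‖ ≤ Real.exp (-(9 / 20) * y) → ∀ θ : ℝ,
      |θ| ≤ Real.pi →
      ‖Complex.exp (saddleExponent κ ρ s y u θ) -
        (Real.exp (-(sizeVariance κ ρ s y * θ ^ 2 / 2)) : ℂ)‖ ≤
      C * Real.exp (-(1 / 20) * y) * Real.exp (-(sizeVariance κ ρ s y * θ ^ 2 / 2)) +
        2 * Real.exp (-Real.exp (1 / 10 * y)) := by
  obtain ⟨C, hC, hrem⟩ := exists_norm_gfRemainder_le hκ.le hρ s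
  refine ⟨2 * C, by positivity, ?_⟩
  have hC1 : ∀ᶠ y in atTop, C * Real.exp (-(1 / 20) * y) ≤ 1 := by
    have := (tendsto_exp_neg_mul (δ := 1 / 20) (by norm_num)).const_mul C
    rw [mul_zero] at this
    exact this.eventually_le_const one_pos
  have hbig : ∀ᶠ y : ℝ in atTop, 1 ≤ κ / 2 * Real.exp (1 / 10 * y) :=
    ((tendsto_exp_mul (by norm_num)).const_mul_atTop (by positivity)).eventually_ge_atTop 1
  filter_upwards [hrem, hC1, hbig, eventually_re_exponent_le hκ hρ s, eventually_ge_atTop 0,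
    eventually_le_sizeVariance hκ hρ s] with y hrem hC1 hbig hout hy hb u hu θ hθ
  have hb0 : 0 ≤ sizeVariance κ ρ s y := le_trans (by positivity) hb
  rcases le_total |θ| (Real.exp (-(2 / 5) * y)) with h | h
  · have hu' : ‖u‖ ≤ Real.exp (-(2 / 5) * y) := hu.trans (Real.exp_le_exp.2 (by nlinarith))
    have hv : ‖-((regressionSlope κ ρ s y : ℂ) * u) + θ * Complex.I‖ ≤
        2 * Real.exp (-(2 / 5) * y) := by
      obtain ⟨hc0, hc1⟩ := regressionSlope_mem_Icc hκ.le hρ s hy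
      refine (norm_add_le _ _).trans ?_
      rw [norm_neg, norm_mul, norm_mul, Complex.norm_I, Complex.norm_real, Complex.norm_real,
        Real.norm_of_nonneg hc0, Real.norm_eq_abs]
      have := mul_le_of_le_one_left (norm_nonneg u) hc1
      linarith
    have h1 := hrem u _ (by linarith [Real.exp_pos (-(2 / 5) * y)]) hv
    set R := gfRemainder κ ρ s y u (-(regressionSlope κ ρ s y * u) + θ * Complex.I) with hR
    have h2 : Complex.exp (saddleExponent κ ρ s y u θ) -
        (Real.exp (-(sizeVariance κ ρ s y * θ ^ 2 / 2)) : ℂ) =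
        (Real.exp (-(sizeVariance κ ρ s y * θ ^ 2 / 2)) : ℂ) * (Complex.exp R - 1) := by
      rw [saddleExponent, Complex.exp_add, mul_sub, mul_one]
      push_cast
      rfl
    rw [h2, norm_mul, Complex.norm_real, Real.norm_of_nonneg (Real.exp_pos _).le]
    have h3 := Complex.norm_exp_sub_one_le (h1.trans hC1)
    calc _ ≤ Real.exp (-(sizeVariance κ ρ s y * θ ^ 2 / 2)) *
          (2 * (C * Real.exp (-(1 / 20) * y))) := by
          gcongr
          exact h3.trans (by gcongr)
      _ ≤ _ := by
          have := Real.exp_pos (-Real.exp (1 / 10 * y))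
          nlinarith
  · have h1 := hout u hu θ h hθ
    have h2 : Real.exp (-(sizeVariance κ ρ s y * θ ^ 2 / 2)) ≤
        Real.exp (-Real.exp (1 / 10 * y)) := by
      apply Real.exp_le_exp.2
      have hθsq : Real.exp (-(4 / 5) * y) ≤ θ ^ 2 := by
        rw [← sq_abs θ]
        calc Real.exp (-(4 / 5) * y) = Real.exp (-(2 / 5) * y) ^ 2 := by
              rw [← Real.exp_nat_mul]; congr 1; push_cast; ring
          _ ≤ _ := by gcongr
      have h3 : κ * Real.exp y * Real.exp (-(4 / 5) * y) ≤ sizeVariance κ ρ s y * θ ^ 2 := by gcongr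
      have h4 : κ * Real.exp y * Real.exp (-(4 / 5) * y) =
          κ * Real.exp (1 / 10 * y) * Real.exp (1 / 10 * y) := by
        rw [mul_assoc, mul_assoc, ← Real.exp_add, ← Real.exp_add]; ring_nf
      have := mul_le_mul_of_nonneg_right hbig (Real.exp_pos (1 / 10 * y)).le
      linarith
    have h3 : ‖Complex.exp (saddleExponent κ ρ s y u θ)‖ ≤ Real.exp (-Real.exp (1 / 10 * y)) := by
      rw [Complex.norm_exp]
      exact Real.exp_le_exp.2 h1
    refine (norm_sub_le _ _).trans ?_
    rw [Complex.norm_real, Real.norm_of_nonneg (Real.exp_pos _).le]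
    have : 0 ≤ 2 * C * Real.exp (-(1 / 20) * y) *
      Real.exp (-(sizeVariance κ ρ s y * θ ^ 2 / 2)) := by positivity
    linarith

/-- After the substitution `τ = √b θ`, with `b` the size variance, the interval of integration
exhausts the line. -/
theorem tendsto_sqrt_mul_integral_gaussian {κ ρ : ℝ} (hκ : 0 < κ) (hρ : 0 ≤ ρ) (s : ℕ) :
    Tendsto (fun y => √(sizeVariance κ ρ s y) *
      ∫ θ in -Real.pi..Real.pi, Real.exp (-(sizeVariance κ ρ s y * θ ^ 2 / 2))) atTop
      (𝓝 √(2 * Real.pi)) := by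
  have hb : Tendsto (fun y => √(sizeVariance κ ρ s y)) atTop atTop := by
    refine Real.tendsto_sqrt_atTop.comp (tendsto_atTop_mono' _
      (eventually_le_sizeVariance hκ hρ s) (Real.tendsto_exp_atTop.const_mul_atTop hκ))
  have h1 : ∀ᶠ y in atTop, ∫ τ in (√(sizeVariance κ ρ s y) * -Real.pi)..
      (√(sizeVariance κ ρ s y) * Real.pi), Real.exp (-(1 / 2) * τ ^ 2) =
      √(sizeVariance κ ρ s y) *
      ∫ θ in -Real.pi..Real.pi, Real.exp (-(sizeVariance κ ρ s y * θ ^ 2 / 2)) := by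
    filter_upwards [eventually_le_sizeVariance hκ hρ s] with y hy
    have hb0 : 0 ≤ sizeVariance κ ρ s y := le_trans (by positivity) hy
    rw [← intervalIntegral.mul_integral_comp_mul_left]
    congr 1
    refine intervalIntegral.integral_congr fun θ _ => ?_
    congr 1
    rw [mul_pow, Real.sq_sqrt hb0]
    ring
  refine Tendsto.congr' h1 ?_
  have h2 : ∫ τ : ℝ, Real.exp (-(1 / 2) * τ ^ 2) = √(2 * Real.pi) := by
    rw [integral_gaussian]
    congr 1
    ring
  rw [← h2]
  refine intervalIntegral_tendsto_integral (integrable_exp_neg_mul_sq (by norm_num)) ?_ ?_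
  · exact hb.atTop_mul_const_of_neg (by linarith [Real.pi_pos])
  · exact hb.atTop_mul_const Real.pi_pos

/-- The limit does not depend on `u`. An arbitrary filter serves both uses: `u` varying jointly with
`n`, and `u = 0`. -/
theorem tendsto_sqrt_mul_integral_saddleExponent {κ ρ : ℝ} (hκ : 0 < κ) (hρ : 0 ≤ ρ) (s : ℕ)
    {ι : Type*} {l : Filter ι} {y : ι → ℝ} {u : ι → ℂ} (hy : Tendsto y l atTop)
    (hu : ∀ᶠ i in l, ‖u i‖ ≤ Real.exp (-(9 / 20) * y i)) :
    Tendsto (fun i => (√(sizeVariance κ ρ s (y i)) : ℂ) *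
      ∫ θ in -Real.pi..Real.pi, Complex.exp (saddleExponent κ ρ s (y i) (u i) θ)) l
      (𝓝 (√(2 * Real.pi) : ℂ)) := by
  obtain ⟨C, hC, hbound⟩ := exists_norm_exp_saddleExponent_sub_le hκ hρ s
  let g : ℝ → ℝ := fun y => √(sizeVariance κ ρ s y) *
      ∫ θ in -Real.pi..Real.pi, Real.exp (-(sizeVariance κ ρ s y * θ ^ 2 / 2))
  have hg : Tendsto g atTop (𝓝 √(2 * Real.pi)) := tendsto_sqrt_mul_integral_gaussian hκ hρ s
  let e : ℝ → ℝ := fun y => C * Real.exp (-(1 / 20) * y) * g y +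
    4 * Real.pi * ((1 + (2 * κ + ρ) * Real.exp (3 * y)) * Real.exp (-Real.exp (1 / 10 * y)))
  have he : Tendsto e atTop (𝓝 0) := by
    have h1 : Tendsto (fun y => C * Real.exp (-(1 / 20) * y) * g y) atTop (𝓝 0) := by
      simpa using ((tendsto_exp_neg_mul (δ := 1 / 20) (by norm_num)).const_mul C).mul hg
    have hE : Tendsto (fun y : ℝ => Real.exp (1 / 10 * y)) atTop atTop :=
      tendsto_exp_mul (by norm_num)
    -- The crude bound on `√b` is of order `exp(3y) = exp(y/10)^30`, still negligible against
    -- `exp(-exp(y/10))`.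
    have h2 := ((Real.tendsto_pow_mul_exp_neg_atTop_nhds_zero 30).comp hE).const_mul (2 * κ + ρ)
    have h3 := (Real.tendsto_pow_mul_exp_neg_atTop_nhds_zero 0).comp hE
    have h4 := (h3.add h2).const_mul (4 * Real.pi)
    have h5 := h1.add h4
    simp only [mul_zero, add_zero] at h5
    refine h5.congr fun y => ?_
    have : Real.exp (3 * y) = Real.exp (1 / 10 * y) ^ 30 := by
      rw [← Real.exp_nat_mul]; congr 1; push_cast; ring
    simp only [e, Function.comp, this]
    ring
  have hmain : ∀ᶠ i in l, ‖(√(sizeVariance κ ρ s (y i)) : ℂ) *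
      (∫ θ in -Real.pi..Real.pi, Complex.exp (saddleExponent κ ρ s (y i) (u i) θ)) -
      (g (y i) : ℂ)‖ ≤ e (y i) := by
    filter_upwards [hu, hy.eventually hbound, hy.eventually (eventually_ge_atTop 0),
      hy.eventually (eventually_le_sizeVariance hκ hρ s)] with i hu hbound hy0 hbκ
    have hbound := hbound (u i) hu
    set b := sizeVariance κ ρ s (y i) with hb
    have hb0 : 0 ≤ b := le_trans (by positivity) hbκ
    have hint1 : IntervalIntegrable (fun θ => Complex.exp (saddleExponent κ ρ s (y i) (u i) θ))
        volume (-Real.pi) Real.pi :=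
      (Complex.continuous_exp.comp (continuous_saddleExponent κ ρ s (y i) (u i))).intervalIntegrable
        _ _
    have hcont : Continuous fun θ : ℝ => Real.exp (-(b * θ ^ 2 / 2)) := by fun_prop
    have hint2 : IntervalIntegrable (fun θ : ℝ => (Real.exp (-(b * θ ^ 2 / 2)) : ℂ))
        volume (-Real.pi) Real.pi :=
      (Complex.continuous_ofReal.comp hcont).intervalIntegrable _ _
    have h1 : (√b : ℂ) * (∫ θ in -Real.pi..Real.pi,
        Complex.exp (saddleExponent κ ρ s (y i) (u i) θ)) - (g (y i) : ℂ) =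
        (√b : ℂ) * ∫ θ in -Real.pi..Real.pi,
          (Complex.exp (saddleExponent κ ρ s (y i) (u i) θ) - (Real.exp (-(b * θ ^ 2 / 2)) : ℂ)) := by
      rw [intervalIntegral.integral_sub hint1 hint2, mul_sub, intervalIntegral.integral_ofReal]
      simp only [g]
      push_cast
      rfl
    rw [h1, norm_mul, Complex.norm_real, Real.norm_of_nonneg (Real.sqrt_nonneg _)]
    have h2 : ‖∫ θ in -Real.pi..Real.pi,
          (Complex.exp (saddleExponent κ ρ s (y i) (u i) θ) - (Real.exp (-(b * θ ^ 2 / 2)) : ℂ))‖ ≤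
        ∫ θ in -Real.pi..Real.pi, (C * Real.exp (-(1 / 20) * y i) * Real.exp (-(b * θ ^ 2 / 2)) +
          2 * Real.exp (-Real.exp (1 / 10 * y i))) := by
      refine intervalIntegral.norm_integral_le_of_norm_le (by linarith [Real.pi_pos]) ?_ ?_
      · refine ae_of_all _ fun θ hθ => ?_
        exact hbound θ (abs_le.2 ⟨hθ.1.le, hθ.2⟩)
      · exact ((hcont.const_mul _).add continuous_const).intervalIntegrable _ _
    rw [intervalIntegral.integral_add ((hcont.const_mul _).intervalIntegrable _ _)
      intervalIntegrable_const, intervalIntegral.integral_const_mul,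
      intervalIntegral.integral_const] at h2
    have h3 : √b ≤ 1 + (2 * κ + ρ) * Real.exp (3 * y i) := by
      have h4 := sizeVariance_le hκ.le hρ s hy0
      have h5 : √b ≤ 1 + b := by
        rw [Real.sqrt_le_left (by linarith)]
        nlinarith
      linarith
    calc _ ≤ √b * (C * Real.exp (-(1 / 20) * y i) *
            (∫ θ in -Real.pi..Real.pi, Real.exp (-(b * θ ^ 2 / 2))) +
          (Real.pi - -Real.pi) • (2 * Real.exp (-Real.exp (1 / 10 * y i)))) := by gcongr
      _ = C * Real.exp (-(1 / 20) * y i) * g (y i) +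
          4 * Real.pi * (√b * Real.exp (-Real.exp (1 / 10 * y i))) := by
          simp only [g, smul_eq_mul]
          ring
      _ ≤ _ := by
          simp only [e]
          gcongr
  have hdiff := squeeze_zero_norm' hmain (he.comp hy)
  have hg' : Tendsto (fun i => (g (y i) : ℂ)) l (𝓝 (√(2 * Real.pi) : ℂ)) :=
    (Complex.continuous_ofReal.tendsto _).comp (hg.comp hy)
  simpa using hdiff.add hg'

/-! ### Asymptotics of the moments and the saddle point -/

theorem tendsto_pow_mul_momentHead_mul_exp_neg (s i k : ℕ) :
    Tendsto (fun y => y ^ k * (momentHead s i y * Real.exp (-y))) atTop (𝓝 0) := by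
  obtain ⟨C, hC, h⟩ := exists_momentHead_le s i (δ := 1 / 2) (by norm_num)
  have h1 := (Real.tendsto_pow_mul_exp_neg_atTop_nhds_zero k).comp
    (tendsto_id.const_mul_atTop (by norm_num : (0 : ℝ) < 1 / 2))
  have h2 := h1.const_mul (C * 2 ^ k)
  rw [mul_zero] at h2
  refine squeeze_zero' ?_ ?_ h2
  · filter_upwards [eventually_ge_atTop 0] with y hy
    have := momentHead_nonneg s i hy
    positivity
  · filter_upwards [eventually_ge_atTop 0] with y hy
    have e : Real.exp (1 / 2 * y) * Real.exp (-y) = Real.exp (-(1 / 2 * y)) := by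
      rw [← Real.exp_add]; ring_nf
    calc _ ≤ y ^ k * (C * Real.exp (1 / 2 * y) * Real.exp (-y)) := by
          have := h y hy
          gcongr
      _ = C * y ^ k * Real.exp (-(1 / 2 * y)) := by rw [← e]; ring
      _ = _ := by
          simp only [Function.comp, id, mul_pow]
          rw [div_pow, one_pow]
          field_simp

/-- The mean total size, in the grand canonical model with parameter `y`. -/
noncomputable def sizeMean (κ ρ : ℝ) (s : ℕ) (y : ℝ) : ℝ := blockMoment κ s 1 y + ρ * y

theorem tendsto_blockMoment_zero_div {κ : ℝ} (hκ : 0 < κ) (s : ℕ) :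
    Tendsto (fun y => blockMoment κ s 0 y / (κ * Real.exp y)) atTop (𝓝 1) := by
  have h := (tendsto_pow_mul_momentHead_mul_exp_neg s 0 0).const_sub 1
  rw [sub_zero] at h
  refine h.congr fun y => ?_
  rw [blockMoment_zero, Real.exp_neg]
  field_simp

theorem tendsto_sizeMean_div {κ : ℝ} (hκ : 0 < κ) (ρ : ℝ) (s : ℕ) :
    Tendsto (fun y => sizeMean κ ρ s y / (κ * (y * Real.exp y))) atTop (𝓝 1) := by
  have h1 := (tendsto_pow_mul_momentHead_mul_exp_neg s 1 0).mul tendsto_inv_atTop_zero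
  have h2 := (Real.tendsto_pow_mul_exp_neg_atTop_nhds_zero 0).const_mul (ρ / κ)
  have h := (h1.const_sub 1).add h2
  simp only [mul_zero, sub_zero, add_zero] at h
  refine h.congr' ?_
  filter_upwards [eventually_gt_atTop 0] with y hy
  rw [sizeMean, blockMoment_one, Real.exp_neg]
  field_simp

theorem tendsto_sizeVariance_div {κ : ℝ} (hκ : 0 < κ) (ρ : ℝ) (s : ℕ) :
    Tendsto (fun y => sizeVariance κ ρ s y / (κ * (y ^ 2 * Real.exp y))) atTop (𝓝 1) := by
  have h1 := (tendsto_pow_mul_momentHead_mul_exp_neg s 2 0).mul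
    (tendsto_inv_atTop_zero.pow 2 (M := ℝ))
  have h2 := ((Real.tendsto_pow_mul_exp_neg_atTop_nhds_zero 0).const_mul (ρ / κ)).mul
    tendsto_inv_atTop_zero
  have h := ((tendsto_inv_atTop_zero.const_add 1).sub h1).add h2
  simp only [mul_zero, zero_mul, sub_zero, add_zero] at h
  refine h.congr' ?_
  filter_upwards [eventually_gt_atTop 0] with y hy
  rw [sizeVariance, blockMoment_two, Real.exp_neg]
  field_simp

/-- The leading terms of `M_0 b` and `M_1²` cancel, since `(y² + y) - y² = y`. This costs a factor
`y` relative to `M_0` and is the source of the second logarithm in the variance. -/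
theorem tendsto_residualVariance_div {κ : ℝ} (hκ : 0 < κ) {ρ : ℝ} (hρ : 0 ≤ ρ) (s : ℕ) :
    Tendsto (fun y => residualVariance κ ρ s y / (κ * Real.exp y / y)) atTop (𝓝 1) := by
  have hh := fun i k => tendsto_pow_mul_momentHead_mul_exp_neg s i k
  have hρ' : ∀ k, Tendsto (fun y => ρ / κ * (y ^ k * Real.exp (-y))) atTop (𝓝 0) := fun k => by
    simpa using (Real.tendsto_pow_mul_exp_neg_atTop_nhds_zero k).const_mul (ρ / κ)
  have hinv : Tendsto (fun y : ℝ => y⁻¹) atTop (𝓝 0) := tendsto_inv_atTop_zero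
  have hnum : Tendsto (fun y => (blockMoment κ s 0 y * sizeVariance κ ρ s y
      - blockMoment κ s 1 y ^ 2) / (κ ^ 2 * (y * Real.exp y ^ 2))) atTop (𝓝 1) := by
    -- Because of that cancellation the leading asymptotics of the factors do not suffice; the exact
    -- quotient is written out with every head and `ρ` term vanishing in the limit.
    have h := (((((hh 2 0).mul hinv).const_sub 1).add (hρ' 0)).sub
      (((hh 0 1).add (hh 0 0)).sub (((hh 0 0).mul ((hh 2 0).mul hinv)).sub
        ((hh 0 0).mul (hρ' 0))))).add
        (((hh 1 0).const_mul 2).sub (((hh 1 0).pow 2).mul hinv))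
    simp only [mul_zero, sub_zero, add_zero, zero_pow two_ne_zero] at h
    refine h.congr' ?_
    filter_upwards [eventually_gt_atTop 0] with y hy
    rw [sizeVariance, blockMoment_zero, blockMoment_one, blockMoment_two, Real.exp_neg]
    field_simp
    ring
  have h := hnum.div (tendsto_sizeVariance_div hκ ρ s) one_ne_zero
  rw [div_one] at h
  refine h.congr' ?_
  filter_upwards [eventually_gt_atTop 0, eventually_le_sizeVariance hκ hρ s] with y hy hb
  have hb0 : sizeVariance κ ρ s y ≠ 0 := by
    have : 0 < κ * Real.exp y := by positivity
    linarith
  rw [Pi.div_apply, residualVariance]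
  field_simp

theorem tendsto_log_sizeMean_div {κ : ℝ} (hκ : 0 < κ) (ρ : ℝ) (s : ℕ) :
    Tendsto (fun y => Real.log (sizeMean κ ρ s y) / y) atTop (𝓝 1) := by
  have h0 := tendsto_sizeMean_div hκ ρ s
  have hlog : Tendsto (fun y => Real.log (sizeMean κ ρ s y / (κ * (y * Real.exp y)))) atTop (𝓝 0) := by
    simpa [Function.comp_def] using (Real.continuousAt_log one_ne_zero).tendsto.comp h0
  have hinv : Tendsto (fun y : ℝ => y⁻¹) atTop (𝓝 0) := tendsto_inv_atTop_zero
  have hly : Tendsto (fun y : ℝ => Real.log y / y) atTop (𝓝 0) :=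
    Real.isLittleO_log_id_atTop.tendsto_div_nhds_zero
  have h := (((hlog.mul hinv).add (hinv.const_mul (Real.log κ))).add hly).add_const 1
  simp only [mul_zero, add_zero, zero_add] at h
  refine h.congr' ?_
  filter_upwards [eventually_gt_atTop 0, h0.eventually_const_lt one_half_lt_one] with y hy hpos
  have hpos' : 0 < κ * (y * Real.exp y) := by positivity
  have hN : sizeMean κ ρ s y ≠ 0 := by
    intro h
    rw [h, zero_div] at hpos
    norm_num at hpos
  rw [Real.log_div hN hpos'.ne', Real.log_mul hκ.ne' (by positivity),
    Real.log_mul hy.ne' (by positivity), Real.log_exp]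
  field_simp
  ring

theorem continuous_sizeMean (κ ρ : ℝ) (s : ℕ) : Continuous (sizeMean κ ρ s) := by
  unfold sizeMean
  simp only [blockMoment_one, momentHead]
  fun_prop

theorem tendsto_sizeMean_atTop {κ : ℝ} (hκ : 0 < κ) (ρ : ℝ) (s : ℕ) :
    Tendsto (sizeMean κ ρ s) atTop atTop := by
  have h1 : Tendsto (fun y => κ * (y * Real.exp y)) atTop atTop :=
    (tendsto_id.atTop_mul_atTop₀ Real.tendsto_exp_atTop).const_mul_atTop hκ
  have h2 := (tendsto_sizeMean_div hκ ρ s).pos_mul_atTop one_pos h1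
  refine h2.congr' ?_
  filter_upwards [eventually_gt_atTop 0] with y hy
  field_simp

theorem exists_saddlePoint {κ : ℝ} (hκ : 0 < κ) {ρ : ℝ} (hρ : 0 ≤ ρ) (s : ℕ) :
    ∃ y : ℕ → ℝ, (∀ n, sizeMean κ ρ s (y n) = n) ∧ Tendsto y atTop atTop := by
  have h0 : sizeMean κ ρ s 0 = 0 := by
    have : momentHead s 1 0 = 0 := by
      refine sum_eq_zero fun j _ => ?_
      rcases j.eq_zero_or_pos with rfl | hj
      · simp
      · simp [hj.ne']
    rw [sizeMean, blockMoment_one, this]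
    ring
  have hex : ∀ n : ℕ, ∃ y, 0 ≤ y ∧ sizeMean κ ρ s y = n := by
    intro n
    obtain ⟨Y, hY0, hY⟩ := ((eventually_ge_atTop 0).and
      ((tendsto_sizeMean_atTop hκ ρ s).eventually_ge_atTop (n : ℝ))).exists
    obtain ⟨y, hy, hyn⟩ := intermediate_value_Icc hY0 (continuous_sizeMean κ ρ s).continuousOn
      ⟨by rw [h0]; positivity, hY⟩
    exact ⟨y, hy.1, hyn⟩
  choose y hy0 hy using hex
  -- Existence came from the intermediate value theorem. For divergence no monotonicity of the mean
  -- size is used: if `y n ≤ K`, then `n` is bounded by the monotone majorant without the head.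
  refine ⟨y, hy, tendsto_atTop.2 fun K => ?_⟩
  filter_upwards [tendsto_natCast_atTop_atTop.eventually_gt_atTop
    (κ * (max K 0 * Real.exp (max K 0)) + ρ * max K 0)] with n hn
  by_contra hlt
  push Not at hlt
  have hle : y n ≤ max K 0 := hlt.le.trans (le_max_left _ _)
  have h1 : (n : ℝ) ≤ κ * (y n * Real.exp (y n)) + ρ * y n := by
    rw [← hy n, sizeMean, blockMoment_one]
    gcongr
    linarith [momentHead_nonneg s 1 (hy0 n)]
  have h2 : κ * (y n * Real.exp (y n)) + ρ * y n ≤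
      κ * (max K 0 * Real.exp (max K 0)) + ρ * max K 0 := by
    have := hy0 n
    gcongr
  linarith

theorem blockMoment_zero_isEquivalent {κ : ℝ} (hκ : 0 < κ) {ρ : ℝ} (s : ℕ) {y : ℕ → ℝ}
    (hn : ∀ n, sizeMean κ ρ s (y n) = n) (hy : Tendsto y atTop atTop) :
    (fun n => blockMoment κ s 0 (y n)) ~[atTop] (fun n : ℕ => (n : ℝ) / Real.log n) := by
  have h := ((tendsto_blockMoment_zero_div hκ s).div (tendsto_sizeMean_div hκ ρ s)
    one_ne_zero).mul (tendsto_log_sizeMean_div hκ ρ s)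
  rw [div_one, one_mul] at h
  refine isEquivalent_of_tendsto_one ?_
  refine (h.comp hy).congr' ?_
  filter_upwards [hy.eventually_gt_atTop 0, eventually_gt_atTop 1] with n hy0 hn1
  have hn0 : (n : ℝ) ≠ 0 := by positivity
  have hlog : Real.log n ≠ 0 := (Real.log_pos (by exact_mod_cast hn1)).ne'
  simp only [Function.comp, Pi.div_apply, hn]
  field_simp

theorem residualVariance_isEquivalent {κ : ℝ} (hκ : 0 < κ) {ρ : ℝ} (hρ : 0 ≤ ρ) (s : ℕ) {y : ℕ → ℝ}
    (hn : ∀ n, sizeMean κ ρ s (y n) = n) (hy : Tendsto y atTop atTop) :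
    (fun n => residualVariance κ ρ s (y n)) ~[atTop]
      (fun n : ℕ => (n : ℝ) / Real.log n ^ 2) := by
  have h := ((tendsto_residualVariance_div hκ hρ s).div (tendsto_sizeMean_div hκ ρ s)
    one_ne_zero).mul ((tendsto_log_sizeMean_div hκ ρ s).pow 2)
  rw [div_one, one_mul, one_pow] at h
  refine isEquivalent_of_tendsto_one ?_
  refine (h.comp hy).congr' ?_
  filter_upwards [hy.eventually_gt_atTop 0, eventually_gt_atTop 1] with n hy0 hn1
  have hn0 : (n : ℝ) ≠ 0 := by positivity
  have hlog : Real.log n ≠ 0 := (Real.log_pos (by exact_mod_cast hn1)).ne'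
  simp only [Function.comp, Pi.div_apply, hn]
  field_simp

/-! ### Convergence of the scaled moment generating function -/

/-- The row polynomial `∑ k, W_{n,k} x ^ k`. -/
noncomputable def whitneyRowPoly (r m s n : ℕ) (x : ℂ) : ℂ :=
  ∑ k ∈ range (n + 1), (assocWhitney r m s n k : ℂ) * x ^ k

theorem whitneyRowPoly_one (r m s n : ℕ) : whitneyRowPoly r m s n 1 = assocDowling r m s n := by
  simp [whitneyRowPoly, assocDowling]

theorem hasSum_exp_gfExponent (r : ℕ) {m : ℕ} (hm : 1 ≤ m) {s : ℕ} (hs : 1 ≤ s) (x w : ℂ) :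
    HasSum (fun n : ℕ => whitneyRowPoly r m s n x / ((m : ℂ) ^ n * n.factorial) * w ^ n)
      (Complex.exp (gfExponent (1 / m) (r / m) s x w)) := by
  have hm' : (m : ℂ) ≠ 0 := by exact_mod_cast (by omega : m ≠ 0)
  have h := hasSum_whitneyGF r hm hs x (w / m)
  convert! h using 1
  · ext n
    rw [whitneyRowPoly, div_pow]
    have : (n.factorial : ℂ) ≠ 0 := by exact_mod_cast n.factorial_ne_zero
    field_simp
  · rw [whitneyGF, gfExponent, mul_div_cancel₀ _ hm']
    congr 1
    push_cast
    field_simp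

/-- The saddle point equation makes the linear term in `v` cancel against the Cauchy factor `exp(-n
v)`. -/
theorem whitneyRowPoly_exp_eq_integral (r : ℕ) {m : ℕ} (hm : 1 ≤ m) {s : ℕ} (hs : 1 ≤ s) (n : ℕ)
    {y : ℝ} (hn : sizeMean (1 / m) (r / m) s y = n) (hb : sizeVariance (1 / m) (r / m) s y ≠ 0)
    (u : ℂ) :
    2 * Real.pi * (whitneyRowPoly r m s n (Complex.exp u) / ((m : ℂ) ^ n * n.factorial) * y ^ n) =
      Complex.exp (gfExponent (1 / m) (r / m) s 1 y) *
      Complex.exp (blockMoment (1 / m) s 0 y * u + residualVariance (1 / m) (r / m) s y * u ^ 2 / 2) *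
      ∫ θ in -Real.pi..Real.pi, Complex.exp (saddleExponent (1 / m) (r / m) s y u θ) := by
  rw [← coeff_mul_pow_eq_integral (hasSum_exp_gfExponent r hm hs (Complex.exp u)) n y
    (-(regressionSlope (1 / m) (r / m) s y * u)), ← intervalIntegral.integral_const_mul]
  refine intervalIntegral.integral_congr fun θ _ => ?_
  have h := gfExponent_sub_eq hb u θ
  have hn' : (blockMoment (1 / m) s 1 y : ℂ) + ((r / m : ℝ) : ℂ) * y = n := by
    rw [sizeMean] at hn
    exact_mod_cast hn
  rw [hn'] at h
  simp only [saddleExponent]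
  rw [← h, ← Complex.exp_add, ← Complex.exp_add, ← Complex.exp_add]
  congr 1
  ring

theorem tendsto_exp_mul_div_atTop {δ : ℝ} (hδ : 0 < δ) :
    Tendsto (fun y : ℝ => Real.exp (δ * y) / y) atTop atTop := by
  have h := ((Real.tendsto_exp_div_pow_atTop 1).comp (tendsto_id.const_mul_atTop hδ)).const_mul_atTop hδ
  refine h.congr' ?_
  filter_upwards [eventually_gt_atTop 0] with y hy
  simp only [Function.comp, id, pow_one]
  field_simp

/-- Here `σ² ~ κ e^y/y` beats `exp(9y/10)`, so bounded `t` give `u = t/σ` in the admissible range of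
the Laplace estimate. -/
theorem eventually_norm_div_sqrt_residualVariance_le {κ ρ : ℝ} (hκ : 0 < κ) (hρ : 0 ≤ ρ) (s : ℕ)
    (K : ℝ) :
    ∀ᶠ y in atTop, 0 < residualVariance κ ρ s y ∧ ∀ t : ℂ, ‖t‖ ≤ K →
      ‖t / (√(residualVariance κ ρ s y) : ℂ)‖ ≤ Real.exp (-(9 / 20) * y) := by
  have h0 := tendsto_residualVariance_div hκ hρ s
  have h1 := h0.pos_mul_atTop one_pos
    ((tendsto_exp_mul_div_atTop (δ := 1 / 10) (by norm_num)).const_mul_atTop hκ)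
  filter_upwards [h0.eventually_const_lt one_half_lt_one, h1.eventually_ge_atTop (K ^ 2),
    eventually_gt_atTop 0] with y hpos hK hy
  have hσ : 0 < residualVariance κ ρ s y := by
    have h2 : 0 < κ * Real.exp y / y := by positivity
    have h3 := (lt_div_iff₀ h2).1 hpos
    exact lt_trans (by positivity) h3
  refine ⟨hσ, fun t ht => ?_⟩
  have hs := Real.sqrt_pos.2 hσ
  rw [norm_div, Complex.norm_real, Real.norm_of_nonneg hs.le, div_le_iff₀ hs]
  refine ht.trans ?_
  have e1 : Real.exp (1 / 10 * y) = Real.exp y * Real.exp (-(9 / 20) * y) ^ 2 := by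
    rw [← Real.exp_nat_mul, ← Real.exp_add]
    congr 1
    push_cast
    ring
  have h4 : K ^ 2 ≤ (Real.exp (-(9 / 20) * y) * √(residualVariance κ ρ s y)) ^ 2 := by
    rw [mul_pow, Real.sq_sqrt hσ.le]
    refine hK.trans_eq ?_
    rw [e1]
    field_simp
  exact le_of_sq_le_sq h4 (by positivity)

/-- The moment generating function of the number of blocks, centered at `a` and scaled by `d`. -/
noncomputable def scaledMGF (r m s n : ℕ) (a d : ℝ) (t : ℂ) : ℂ :=
  ∑ k ∈ range (n + 1), ((assocWhitney r m s n k : ℝ) / (assocDowling r m s n : ℝ) : ℝ) *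
    Complex.exp (t * (((k : ℝ) - a) / d : ℝ))

theorem scaledMGF_eq (r m s n : ℕ) (a d : ℝ) (t : ℂ) :
    scaledMGF r m s n a d t = whitneyRowPoly r m s n (Complex.exp (t / d)) /
      whitneyRowPoly r m s n 1 * Complex.exp (-(a * (t / d))) := by
  rw [whitneyRowPoly_one, scaledMGF, whitneyRowPoly, sum_div, sum_mul]
  refine sum_congr rfl fun k _ => ?_
  have : Complex.exp (t * (((k : ℝ) - a) / d : ℝ)) =
      Complex.exp (t / d) ^ k * Complex.exp (-(a * (t / d))) := by
    rw [← Complex.exp_nat_mul, ← Complex.exp_add]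
    congr 1
    push_cast
    ring
  rw [this]
  push_cast
  ring

/-- In the quotient of the integral formulas at `u = t/σ` and at `0` all prefactors cancel except
`exp(M_0 u + t²/2)`, and centering removes `M_0 u`. The argument may move: product filters then give
locally uniform convergence, and random scalings may be replaced by asymptotically equal ones. -/
theorem tendsto_scaledMGF (r : ℕ) {m : ℕ} (hm : 1 ≤ m) {s : ℕ} (hs : 1 ≤ s) {y : ℕ → ℝ}
    (hn : ∀ n, sizeMean (1 / m) (r / m) s (y n) = n) (hy : Tendsto y atTop atTop)
    {ι : Type*} {l : Filter ι} {n : ι → ℕ} {t : ι → ℂ} {t₀ : ℂ}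
    (hnl : Tendsto n l atTop) (ht : Tendsto t l (𝓝 t₀)) :
    Tendsto (fun i => scaledMGF r m s (n i) (blockMoment (1 / m) s 0 (y (n i)))
      √(residualVariance (1 / m) (r / m) s (y (n i))) (t i)) l (𝓝 (Complex.exp (t₀ ^ 2 / 2))) := by
  have hm0 : (0 : ℝ) < m := by exact_mod_cast hm
  have hκ : (0 : ℝ) < 1 / m := by positivity
  have hρ : (0 : ℝ) ≤ r / m := by positivity
  have hyl := hy.comp hnl
  let u : ι → ℂ := fun i => t i / (√(residualVariance (1 / m) (r / m) s (y (n i))) : ℂ)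
  have hsmall := hyl.eventually
    (eventually_norm_div_sqrt_residualVariance_le hκ hρ s (‖t₀‖ + 1))
  have htn : ∀ᶠ i in l, ‖t i‖ ≤ ‖t₀‖ + 1 := by
    have := ht.norm.eventually_le_const (lt_add_one ‖t₀‖)
    exact this
  have hu : ∀ᶠ i in l, ‖u i‖ ≤ Real.exp (-(9 / 20) * y (n i)) := by
    filter_upwards [hsmall, htn] with i h1 h2 using h1.2 _ h2
  have hI := tendsto_sqrt_mul_integral_saddleExponent hκ hρ s hyl hu
  have hI0 := tendsto_sqrt_mul_integral_saddleExponent hκ hρ s (u := fun _ => 0) hyl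
    (Eventually.of_forall fun i => by simpa using (Real.exp_pos _).le)
  have hpi : (√(2 * Real.pi) : ℂ) ≠ 0 := by
    exact_mod_cast (Real.sqrt_pos.2 (by positivity)).ne'
  have hratio := hI.div hI0 hpi
  rw [div_self hpi] at hratio
  have hexp : Tendsto (fun i => Complex.exp (t i ^ 2 / 2)) l (𝓝 (Complex.exp (t₀ ^ 2 / 2))) :=
    (Complex.continuous_exp.tendsto _).comp ((ht.pow 2).div_const 2)
  have h := hexp.mul hratio
  rw [mul_one] at h
  refine h.congr' ?_
  filter_upwards [hsmall, hyl.eventually (eventually_le_sizeVariance hκ hρ s),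
    hyl.eventually_gt_atTop 0] with i hσ hb hy0
  have hσ := hσ.1
  simp only [Function.comp] at hσ hb hy0
  have hb0 : 0 < sizeVariance (1 / m) (r / m) s (y (n i)) := lt_of_lt_of_le (by positivity) hb
  rw [scaledMGF_eq]
  have h1 := whitneyRowPoly_exp_eq_integral r hm hs (n i) (hn (n i)) hb0.ne' (u i)
  have h0 := whitneyRowPoly_exp_eq_integral r hm hs (n i) (hn (n i)) hb0.ne' 0
  have hσu : (residualVariance (1 / m) (r / m) s (y (n i)) : ℂ) * u i ^ 2 = t i ^ 2 := by
    simp only [u]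
    have hne : (√(residualVariance (1 / m) (r / m) s (y (n i))) : ℂ) ≠ 0 := by
      exact_mod_cast (Real.sqrt_pos.2 hσ).ne'
    have hsq : (√(residualVariance (1 / m) (r / m) s (y (n i))) : ℂ) ^ 2 =
        residualVariance (1 / m) (r / m) s (y (n i)) := by
      exact_mod_cast Real.sq_sqrt hσ.le
    rw [div_pow, hsq, mul_div_cancel₀]
    exact_mod_cast hσ.ne'
  rw [hσu] at h1
  simp only [Complex.exp_zero, mul_zero, ne_eq, OfNat.ofNat_ne_zero, not_false_eq_true, zero_pow,
    zero_div, add_zero, mul_one] at h0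
  have hmc : (m : ℂ) ≠ 0 := by exact_mod_cast hm0.ne'
  have hyc : (y (n i) : ℂ) ≠ 0 := by exact_mod_cast hy0.ne'
  have hpic : (Real.pi : ℂ) ≠ 0 := by exact_mod_cast Real.pi_ne_zero
  have hf : ((n i).factorial : ℂ) ≠ 0 := by exact_mod_cast (n i).factorial_ne_zero
  have hbc : (√(sizeVariance (1 / m) (r / m) s (y (n i))) : ℂ) ≠ 0 := by
    exact_mod_cast (Real.sqrt_pos.2 hb0).ne'
  set G := Complex.exp (gfExponent (1 / m) (r / m) s 1 (y (n i))) with hG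
  have hG0 : G ≠ 0 := Complex.exp_ne_zero _
  set A : ℂ := (m : ℂ) ^ (n i) * (n i).factorial * G / (2 * Real.pi * (y (n i) : ℂ) ^ (n i)) with hA
  have hA0 : A ≠ 0 :=
    div_ne_zero (mul_ne_zero (mul_ne_zero (pow_ne_zero _ hmc) hf) hG0)
      (mul_ne_zero (mul_ne_zero two_ne_zero hpic) (pow_ne_zero _ hyc))
  have h1' : whitneyRowPoly r m s (n i) (Complex.exp (u i)) = A *
      (Complex.exp (blockMoment (1 / m) s 0 (y (n i)) * u i + t i ^ 2 / 2) *
      ∫ θ in -Real.pi..Real.pi,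
        Complex.exp (saddleExponent (1 / m) (r / m) s (y (n i)) (u i) θ)) := by
    rw [hA]
    field_simp
    field_simp at h1
    linear_combination h1
  have h0' : whitneyRowPoly r m s (n i) 1 = A * ∫ θ in -Real.pi..Real.pi,
        Complex.exp (saddleExponent (1 / m) (r / m) s (y (n i)) 0 θ) := by
    rw [hA]
    field_simp
    field_simp at h0
    linear_combination h0
  simp only [Pi.div_apply, Function.comp]
  rw [h1', h0', mul_div_mul_left _ _ hA0, mul_div_mul_left _ _ hbc, Complex.exp_add]
  have e : Complex.exp (blockMoment (1 / m) s 0 (y (n i)) * u i) *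
      Complex.exp (-(blockMoment (1 / m) s 0 (y (n i)) * u i)) = 1 := by
    rw [← Complex.exp_add, add_neg_cancel, Complex.exp_zero]
  linear_combination (-Complex.exp (t i ^ 2 / 2) * ((∫ θ in -Real.pi..Real.pi,
        Complex.exp (saddleExponent (1 / m) (r / m) s (y (n i)) (u i) θ)) /
      ∫ θ in -Real.pi..Real.pi,
        Complex.exp (saddleExponent (1 / m) (r / m) s (y (n i)) 0 θ))) * e

/-! ### Positivity of the row sums and the block law -/

theorem assocDowling_eq_iteratedDeriv (r : ℕ) {m : ℕ} (hm : 1 ≤ m) {s : ℕ} (hs : 1 ≤ s) (n : ℕ) :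
    (assocDowling r m s n : ℂ) = iteratedDeriv n (whitneyGF r m s 1) 0 := by
  rw [← sum_assocWhitney_mul_pow r hm hs, assocDowling]
  simp

theorem assocDowling_pos (r : ℕ) {m : ℕ} (hm : 1 ≤ m) {s : ℕ} (hs : 1 ≤ s) {n : ℕ} (hn : s ≤ n) :
    0 < assocDowling r m s n := by
  induction r with
  | zero =>
    obtain ⟨n, rfl⟩ := Nat.exists_eq_add_of_le' (hs.trans hn)
    have h0 : assocDowling 0 m s 0 = 1 := by
      have h := assocDowling_eq_iteratedDeriv 0 hm hs 0
      obtain ⟨s, rfl⟩ := Nat.exists_eq_add_of_le' hs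
      simp only [iteratedDeriv_zero, whitneyGF, sum_range_succ'] at h
      simp at h
      exact_mod_cast h
    have h : assocDowling 0 m s (n + 1) = ∑ j ∈ range (n + 1),
        n.choose j * (if s ≤ j + 1 then m ^ j else 0) * assocDowling 0 m s (n - j) := by
      have h1 := iteratedDeriv_whitneyGF_zero hm hs 1 n
      simp only [← assocDowling_eq_iteratedDeriv 0 hm hs] at h1
      simp only [one_mul] at h1
      exact_mod_cast h1
    rw [h]
    -- The last term counts the partitions into a single block, which is large enough as `s ≤ n +
    -- 1`.
    refine lt_of_lt_of_le ?_ (single_le_sum (fun _ _ => Nat.zero_le _) (self_mem_range_succ n))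
    rw [if_pos hn, Nat.sub_self, h0, Nat.choose_self, one_mul, mul_one]
    positivity
  | succ r ih =>
    have h : assocDowling (r + 1) m s n = ∑ j ∈ range (n + 1),
        n.choose j * assocDowling r m s (n - j) := by
      have h1 := iteratedDeriv_whitneyGF_succ r m s 1 n
      simp only [← assocDowling_eq_iteratedDeriv _ hm hs] at h1
      exact_mod_cast h1
    rw [h]
    -- The term `j = 0`: the new distinguished element forms a block alone.
    refine lt_of_lt_of_le ?_ (single_le_sum (fun _ _ => Nat.zero_le _)
      (mem_range.2 n.succ_pos))
    simpa using ih

/-- The probability that there are `k` non-distinguished blocks. -/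
noncomputable def blockProb (r m s n k : ℕ) : ℝ :=
  (assocWhitney r m s n k : ℝ) / (assocDowling r m s n : ℝ)

theorem blockProb_nonneg (r m s n k : ℕ) : 0 ≤ blockProb r m s n k := by
  unfold blockProb
  positivity

theorem sum_blockProb {r m s n : ℕ} (h : 0 < assocDowling r m s n) :
    ∑ k ∈ range (n + 1), blockProb r m s n k = 1 := by
  simp only [blockProb]
  rw [← sum_div, div_eq_one_iff_eq (by positivity), assocDowling]
  push_cast
  rfl

theorem blockLaw_eq_sum (r m s n : ℕ) : blockLaw r m s n = ∑ k ∈ range (n + 1),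
    ENNReal.ofReal (blockProb r m s n k) • Measure.dirac (k : ℝ) := rfl

theorem isProbabilityMeasure_blockLaw {r m s n : ℕ} (h : 0 < assocDowling r m s n) :
    IsProbabilityMeasure (blockLaw r m s n) := by
  constructor
  simp only [blockLaw_eq_sum, Measure.coe_finsetSum, Finset.sum_apply, Measure.smul_apply,
    measure_univ, smul_eq_mul, mul_one]
  rw [← ENNReal.ofReal_sum_of_nonneg (fun k _ => blockProb_nonneg r m s n k)]
  exact (congrArg ENNReal.ofReal (sum_blockProb h)).trans ENNReal.ofReal_one

theorem integral_blockLaw {E : Type*} [NormedAddCommGroup E] [NormedSpace ℝ E] [CompleteSpace E]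
    (r m s n : ℕ) (f : ℝ → E) :
    ∫ x, f x ∂(blockLaw r m s n) = ∑ k ∈ range (n + 1), blockProb r m s n k • f k := by
  rw [blockLaw_eq_sum, integral_finsetSum_measure]
  · refine sum_congr rfl fun k _ => ?_
    rw [integral_smul_measure, integral_dirac, ENNReal.toReal_ofReal (blockProb_nonneg r m s n k)]
  · exact fun k _ => (integrable_dirac (by simp)).smul_measure ENNReal.ofReal_ne_top

theorem blockMean_eq (r m s n : ℕ) :
    blockMean r m s n = ∑ k ∈ range (n + 1), blockProb r m s n k * k := by
  rw [blockMean, integral_blockLaw]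
  rfl

theorem blockVariance_eq (r m s n : ℕ) :
    blockVariance r m s n =
      ∑ k ∈ range (n + 1), blockProb r m s n k * (k - blockMean r m s n) ^ 2 := by
  rw [blockVariance, variance_eq_integral aemeasurable_id, integral_blockLaw]
  rfl

theorem scaledMGF_eq_sum_blockProb (r m s n : ℕ) (a d : ℝ) (t : ℂ) :
    scaledMGF r m s n a d t = ∑ k ∈ range (n + 1), (blockProb r m s n k : ℂ) *
      Complex.exp (t * (((k : ℝ) - a) / d : ℝ)) := rfl

theorem hasDerivAt_scaledMGF (r m s n : ℕ) (a d : ℝ) (t : ℂ) :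
    HasDerivAt (scaledMGF r m s n a d) (∑ k ∈ range (n + 1), (blockProb r m s n k : ℂ) *
      (Complex.exp (t * (((k : ℝ) - a) / d : ℝ)) * (((k : ℝ) - a) / d : ℝ))) t := by
  refine HasDerivAt.fun_sum fun k _ => ?_
  have h := ((hasDerivAt_id t).mul_const ((((k : ℝ) - a) / d : ℝ) : ℂ)).cexp
  simp only [id, one_mul] at h
  exact h.const_mul _

theorem deriv_scaledMGF_zero (r m s n : ℕ) (a d : ℝ) :
    deriv (scaledMGF r m s n a d) 0 =
      (∑ k ∈ range (n + 1), blockProb r m s n k * ((k - a) / d) : ℝ) := by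
  rw [(hasDerivAt_scaledMGF r m s n a d 0).deriv]
  push_cast
  simp

theorem deriv_deriv_scaledMGF_zero (r m s n : ℕ) (a d : ℝ) :
    deriv (deriv (scaledMGF r m s n a d)) 0 =
      (∑ k ∈ range (n + 1), blockProb r m s n k * ((k - a) / d) ^ 2 : ℝ) := by
  have h : deriv (scaledMGF r m s n a d) = fun t => ∑ k ∈ range (n + 1), (blockProb r m s n k : ℂ) *
      (Complex.exp (t * (((k : ℝ) - a) / d : ℝ)) * (((k : ℝ) - a) / d : ℝ)) :=
    funext fun t => (hasDerivAt_scaledMGF r m s n a d t).deriv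
  rw [h]
  have h2 : HasDerivAt (fun t : ℂ => ∑ k ∈ range (n + 1), (blockProb r m s n k : ℂ) *
      (Complex.exp (t * (((k : ℝ) - a) / d : ℝ)) * (((k : ℝ) - a) / d : ℝ)))
      (∑ k ∈ range (n + 1), (blockProb r m s n k : ℂ) *
      (Complex.exp (0 * (((k : ℝ) - a) / d : ℝ)) * (((k : ℝ) - a) / d : ℝ) *
        (((k : ℝ) - a) / d : ℝ))) 0 := by
    refine HasDerivAt.fun_sum fun k _ => ?_
    have h := ((hasDerivAt_id (0 : ℂ)).mul_const ((((k : ℝ) - a) / d : ℝ) : ℂ)).cexp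
    simp only [id, one_mul] at h
    exact (h.mul_const _).const_mul _
  rw [h2.deriv]
  push_cast
  simp [pow_two]

/-! ### Mean and variance -/

theorem tendstoLocallyUniformlyOn_of_tendsto_prod {F : ℕ → ℂ → ℂ} {f : ℂ → ℂ} (hf : Continuous f)
    (h : ∀ t₀, Tendsto (fun p : ℕ × ℂ => F p.1 p.2) (atTop ×ˢ 𝓝 t₀) (𝓝 (f t₀))) :
    TendstoLocallyUniformlyOn F f atTop Set.univ := by
  rw [isOpen_univ.tendstoLocallyUniformlyOn_iff_forall_tendsto]
  intro t _
  have h1 : Tendsto (fun p : ℕ × ℂ => f p.2) (atTop ×ˢ 𝓝 t) (𝓝 (f t)) :=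
    (hf.tendsto t).comp tendsto_snd
  exact (h1.prodMk_nhds (h t)).mono_right (nhds_le_uniformity (f t))

/-- Convergence of the first two moments of a sequence of laws whose scaled moment generating
functions converge to that of the standard normal law. -/
theorem tendsto_moments_of_scaledMGF {r m s : ℕ} {a d : ℕ → ℝ}
    (h : ∀ t₀, Tendsto (fun p : ℕ × ℂ => scaledMGF r m s p.1 (a p.1) (d p.1) p.2) (atTop ×ˢ 𝓝 t₀)
      (𝓝 (Complex.exp (t₀ ^ 2 / 2)))) :
    Tendsto (fun n => ∑ k ∈ range (n + 1), blockProb r m s n k * ((k - a n) / d n)) atTop (𝓝 0) ∧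
    Tendsto (fun n => ∑ k ∈ range (n + 1), blockProb r m s n k * ((k - a n) / d n) ^ 2)
      atTop (𝓝 1) := by
  have hd : ∀ t : ℂ, HasDerivAt (fun t : ℂ => Complex.exp (t ^ 2 / 2))
      (Complex.exp (t ^ 2 / 2) * t) t := by
    intro t
    have := (((hasDerivAt_id t).pow 2).div_const 2).cexp
    convert! this using 1
    simp
  have hd1 : deriv (fun t : ℂ => Complex.exp (t ^ 2 / 2)) = fun t => Complex.exp (t ^ 2 / 2) * t :=
    funext fun t => (hd t).deriv
  have hd2 : deriv (fun t : ℂ => Complex.exp (t ^ 2 / 2) * t) 0 = 1 := by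
    have := (HasDerivAt.fun_mul (hd 0) (hasDerivAt_id' (0 : ℂ))).deriv
    simpa using this
  have hlu := tendstoLocallyUniformlyOn_of_tendsto_prod
    (F := fun n => scaledMGF r m s n (a n) (d n)) (by fun_prop) h
  have hdiff : ∀ n, Differentiable ℂ (scaledMGF r m s n (a n) (d n)) := fun n t =>
    (hasDerivAt_scaledMGF r m s n (a n) (d n) t).differentiableAt
  -- Weierstrass: locally uniform limits of holomorphic functions may be differentiated, here twice;
  -- the derivatives at 0 are the first two moments.
  have h1 := hlu.deriv (Eventually.of_forall fun n => (hdiff n).differentiableOn) isOpen_univ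
  have h2 := h1.deriv (Eventually.of_forall fun n =>
    ((hdiff n).differentiableOn.deriv isOpen_univ)) isOpen_univ
  have h1' := h1.tendsto_at (Set.mem_univ 0)
  have h2' := h2.tendsto_at (Set.mem_univ 0)
  simp only [Function.comp, deriv_scaledMGF_zero, deriv_deriv_scaledMGF_zero, hd1, hd2] at h1' h2'
  constructor
  · simpa only [Function.comp_def, Complex.ofReal_re, mul_zero, Complex.zero_re, Complex.one_re]
      using (Complex.continuous_re.tendsto _).comp h1'
  · simpa only [Function.comp_def, Complex.ofReal_re, mul_zero, Complex.zero_re, Complex.one_re]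
      using (Complex.continuous_re.tendsto _).comp h2'

theorem blockMean_blockVariance_asymptotics (r : ℕ) {m : ℕ} (hm : 1 ≤ m) {s : ℕ} (hs : 1 ≤ s)
    {y : ℕ → ℝ} (hn : ∀ n, sizeMean (1 / m) (r / m) s (y n) = n) (hy : Tendsto y atTop atTop) :
    Tendsto (fun n => (blockMean r m s n - blockMoment (1 / m) s 0 (y n)) /
      √(residualVariance (1 / m) (r / m) s (y n))) atTop (𝓝 0) ∧
    Tendsto (fun n => blockVariance r m s n / residualVariance (1 / m) (r / m) s (y n))
      atTop (𝓝 1) := by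
  have hm0 : (0 : ℝ) < m := by exact_mod_cast hm
  have hκ : (0 : ℝ) < 1 / m := by positivity
  have hρ : (0 : ℝ) ≤ r / m := by positivity
  obtain ⟨h1, h2⟩ := tendsto_moments_of_scaledMGF (r := r) (m := m) (s := s)
    (a := fun n => blockMoment (1 / m) s 0 (y n))
    (d := fun n => √(residualVariance (1 / m) (r / m) s (y n)))
    (fun t₀ => tendsto_scaledMGF r hm hs hn hy (n := Prod.fst) (t := Prod.snd)
      tendsto_fst tendsto_snd)
  have hmean : ∀ n ≥ s, ∀ a d : ℝ,
      ∑ k ∈ range (n + 1), blockProb r m s n k * ((k - a) / d) = (blockMean r m s n - a) / d := by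
    intro n hns a d
    have hp := sum_blockProb (assocDowling_pos r hm hs hns)
    calc _ = (∑ k ∈ range (n + 1), blockProb r m s n k * k -
          (∑ k ∈ range (n + 1), blockProb r m s n k) * a) / d := by
          rw [sum_mul, ← sum_sub_distrib, sum_div]
          exact sum_congr rfl fun k _ => by ring
      _ = _ := by rw [hp, one_mul, ← blockMean_eq]
  have h1' := h1.congr' ((eventually_ge_atTop s).mono fun n hns => hmean n hns _ _)
  refine ⟨h1', ?_⟩
  -- The second moment is centered at `M_0`, not at the mean; the correction is the square of the
  -- first moment, which vanishes in the limit.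
  have h3 := h2.sub (h1'.pow 2)
  rw [zero_pow two_ne_zero, sub_zero] at h3
  refine h3.congr' ?_
  filter_upwards [eventually_ge_atTop s,
    hy.eventually (eventually_norm_div_sqrt_residualVariance_le hκ hρ s 0)] with n hns hσ
  have hσ := hσ.1
  have hp := sum_blockProb (assocDowling_pos r hm hs hns)
  set a := blockMoment (1 / m) s 0 (y n)
  set v := residualVariance (1 / m) (r / m) s (y n)
  set μ := blockMean r m s n with hμ
  have hsq : √v ^ 2 = v := Real.sq_sqrt hσ.le
  have e : ∑ k ∈ range (n + 1), blockProb r m s n k * (k - a) ^ 2 =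
      blockVariance r m s n + (μ - a) ^ 2 := by
    have h0 : ∑ k ∈ range (n + 1), blockProb r m s n k * (k - μ) = 0 := by
      have := hmean n hns μ 1
      simpa [← hμ] using this
    calc _ = ∑ k ∈ range (n + 1), blockProb r m s n k * (k - μ) ^ 2 +
          2 * (μ - a) * ∑ k ∈ range (n + 1), blockProb r m s n k * (k - μ) +
          (∑ k ∈ range (n + 1), blockProb r m s n k) * (μ - a) ^ 2 := by
          rw [mul_sum, sum_mul, ← sum_add_distrib, ← sum_add_distrib]
          exact sum_congr rfl fun k _ => by ring
      _ = _ := by rw [h0, hp, ← blockVariance_eq]; ring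
  have e2 : ∑ k ∈ range (n + 1), blockProb r m s n k * ((k - a) / √v) ^ 2 =
      (blockVariance r m s n + (μ - a) ^ 2) / v := by
    rw [← e, sum_div]
    refine sum_congr rfl fun k _ => ?_
    rw [div_pow, hsq]
    ring
  rw [e2, div_pow, hsq]
  ring

theorem blockMean_isEquivalent (r : ℕ) {m : ℕ} (hm : 1 ≤ m) {s : ℕ} (hs : 1 ≤ s)
    {y : ℕ → ℝ} (hn : ∀ n, sizeMean (1 / m) (r / m) s (y n) = n) (hy : Tendsto y atTop atTop) :
    (fun n : ℕ => blockMean r m s n) ~[atTop] (fun n : ℕ => (n : ℝ) / Real.log n) := by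
  have hm0 : (0 : ℝ) < m := by exact_mod_cast hm
  have hκ : (0 : ℝ) < 1 / m := by positivity
  have hρ : (0 : ℝ) ≤ r / m := by positivity
  refine IsEquivalent.trans ?_ (blockMoment_zero_isEquivalent hκ s hn hy)
  obtain ⟨h1, -⟩ := blockMean_blockVariance_asymptotics r hm hs hn hy
  have hM0 : Tendsto (fun n => blockMoment (1 / m) s 0 (y n)) atTop atTop := by
    have h := (tendsto_blockMoment_zero_div hκ s).pos_mul_atTop one_pos
      (Real.tendsto_exp_atTop.const_mul_atTop hκ)
    have h' : Tendsto (blockMoment (1 / m) s 0) atTop atTop := h.congr fun y =>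
      div_mul_cancel₀ _ (mul_pos hκ (Real.exp_pos y)).ne'
    exact h'.comp hy
  have hinv : Tendsto (fun n => (√(blockMoment (1 / m) s 0 (y n)))⁻¹) atTop (𝓝 0) :=
    tendsto_inv_atTop_zero.comp (Real.tendsto_sqrt_atTop.comp hM0)
  -- Since `σ² ≤ M_0`, the ratio `σ/M_0` is at most `M_0^(-1/2)`; hence a shift of the mean by
  -- `o(σ)` is `o(M_0)`.
  have hratio0 : Tendsto (fun n => √(residualVariance (1 / m) (r / m) s (y n)) /
      blockMoment (1 / m) s 0 (y n)) atTop (𝓝 0) := by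
    refine squeeze_zero' ?_ ?_ hinv
    · filter_upwards [hM0.eventually_gt_atTop 0] with n hpos
      positivity
    · filter_upwards [hM0.eventually_gt_atTop 0, hy.eventually (eventually_le_sizeVariance hκ hρ s)]
        with n hpos hb
      have hb0 : 0 ≤ sizeVariance (1 / m) (r / m) s (y n) := le_trans (by positivity) hb
      have h2 : residualVariance (1 / m) (r / m) s (y n) ≤ blockMoment (1 / m) s 0 (y n) := by
        rw [residualVariance]
        linarith [div_nonneg (sq_nonneg (blockMoment (1 / m) s 1 (y n))) hb0]
      rw [div_le_iff₀ hpos]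
      refine (Real.sqrt_le_sqrt h2).trans_eq ?_
      rw [inv_mul_eq_div, Real.div_sqrt]
  have h := (h1.mul hratio0).add_const 1
  rw [zero_mul, zero_add] at h
  refine isEquivalent_of_tendsto_one (h.congr' ?_)
  filter_upwards [hM0.eventually_gt_atTop 0,
    hy.eventually (eventually_norm_div_sqrt_residualVariance_le hκ hρ s 0)] with n hpos hσ
  have hσ' := Real.sqrt_pos.2 hσ.1
  rw [Pi.div_apply]
  field_simp
  ring

theorem blockVariance_isEquivalent (r : ℕ) {m : ℕ} (hm : 1 ≤ m) {s : ℕ} (hs : 1 ≤ s)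
    {y : ℕ → ℝ} (hn : ∀ n, sizeMean (1 / m) (r / m) s (y n) = n) (hy : Tendsto y atTop atTop) :
    (fun n : ℕ => blockVariance r m s n) ~[atTop] (fun n : ℕ => (n : ℝ) / Real.log n ^ 2) := by
  have hm0 : (0 : ℝ) < m := by exact_mod_cast hm
  exact (isEquivalent_of_tendsto_one (blockMean_blockVariance_asymptotics r hm hs hn hy).2).trans
    (residualVariance_isEquivalent (by positivity) (by positivity) s hn hy)

/-! ### Asymptotic normality -/

/-- Passes from the normalization by `a`, `d` (saddle point quantities) to that by `b`, `v` (true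
mean and standard deviation): the argument is rescaled by `d/v` and a phase appears. -/
theorem charFun_map_blockLaw (r m s n : ℕ) (a b d v t : ℝ) (hd : d ≠ 0) :
    charFun ((blockLaw r m s n).map (fun x => (x - b) / v)) t =
      scaledMGF r m s n a d ((t * (d / v) : ℝ) * Complex.I) *
        Complex.exp (-((t * ((b - a) / v) : ℝ) * Complex.I)) := by
  rw [charFun_apply_real, integral_map (by fun_prop) (by fun_prop), integral_blockLaw,
    scaledMGF_eq_sum_blockProb, sum_mul]
  refine sum_congr rfl fun k _ => ?_
  rw [Complex.real_smul, mul_assoc (blockProb r m s n k : ℂ), ← Complex.exp_add]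
  congr 2
  have hd' : (d : ℂ) ≠ 0 := by exact_mod_cast hd
  push_cast
  by_cases hv : (v : ℂ) = 0
  · simp [hv]
  · field_simp
    ring

theorem tendsto_blockLaw_real_Iic (r : ℕ) {m : ℕ} (hm : 1 ≤ m) {s : ℕ} (hs : 1 ≤ s)
    {y : ℕ → ℝ} (hn : ∀ n, sizeMean (1 / m) (r / m) s (y n) = n) (hy : Tendsto y atTop atTop)
    (t : ℝ) :
    Tendsto (fun n : ℕ => (blockLaw r m s n).real
        {x : ℝ | (x - blockMean r m s n) / √(blockVariance r m s n) ≤ t})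
      atTop (𝓝 ((gaussianReal 0 1).real (Set.Iic t))) := by
  have hm0 : (0 : ℝ) < m := by exact_mod_cast hm
  have hκ : (0 : ℝ) < 1 / m := by positivity
  have hρ : (0 : ℝ) ≤ r / m := by positivity
  let g : ℕ → ℝ → ℝ := fun n x => (x - blockMean r m s n) / √(blockVariance r m s n)
  have hg : ∀ n, Measurable (g n) := fun n => by fun_prop
  have hprob : ∀ n, IsProbabilityMeasure (blockLaw r m s (n + s)) := fun n =>
    isProbabilityMeasure_blockLaw (assocDowling_pos r hm hs (Nat.le_add_left s n))
  -- Indices are shifted by `s` because the law is known to be a probability measure only from `n =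
  -- s` on.
  let ν : ℕ → ProbabilityMeasure ℝ := fun n =>
    ⟨(blockLaw r m s (n + s)).map (g (n + s)),
      Measure.isProbabilityMeasure_map (hg _).aemeasurable⟩
  let γ : ProbabilityMeasure ℝ := ⟨gaussianReal 0 1, inferInstance⟩
  obtain ⟨h1, h2⟩ := blockMean_blockVariance_asymptotics r hm hs hn hy
  have hσpos := hy.eventually (eventually_norm_div_sqrt_residualVariance_le hκ hρ s 0)
  have hratio : Tendsto (fun n => √(residualVariance (1 / m) (r / m) s (y n)) /
      √(blockVariance r m s n)) atTop (𝓝 1) := by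
    have h3 := ((Real.continuous_sqrt.tendsto _).comp h2).inv₀ (by simp)
    simp only [Real.sqrt_one, inv_one] at h3
    refine h3.congr' ?_
    filter_upwards [hσpos] with n hσ
    simp only [Function.comp]
    rw [Real.sqrt_div' _ hσ.1.le, inv_div]
  have hshift : Tendsto (fun n => (blockMean r m s n - blockMoment (1 / m) s 0 (y n)) /
      √(blockVariance r m s n)) atTop (𝓝 0) := by
    have h3 := h1.mul hratio
    rw [zero_mul] at h3
    refine h3.congr' ?_
    filter_upwards [hσpos] with n hσ
    have := Real.sqrt_pos.2 hσ.1
    field_simp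
  have hchar : ∀ τ : ℝ, Tendsto (fun n => charFun ((blockLaw r m s n).map (g n)) τ) atTop
      (𝓝 (charFun (gaussianReal 0 1) τ)) := by
    intro τ
    have ht : Tendsto (fun n => ((τ * (√(residualVariance (1 / m) (r / m) s (y n)) /
        √(blockVariance r m s n)) : ℝ) : ℂ) * Complex.I) atTop (𝓝 (τ * Complex.I)) := by
      have := (Complex.continuous_ofReal.tendsto _).comp (hratio.const_mul τ)
      rw [mul_one] at this
      exact this.mul_const _
    have hM := tendsto_scaledMGF r hm hs hn hy tendsto_id ht
    have hE : Tendsto (fun n => Complex.exp (-((τ * ((blockMean r m s n -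
        blockMoment (1 / m) s 0 (y n)) / √(blockVariance r m s n)) : ℝ) * Complex.I)))
        atTop (𝓝 1) := by
      have h3 := (Complex.continuous_ofReal.tendsto _).comp (hshift.const_mul τ)
      have h4 := (Complex.continuous_exp.tendsto _).comp ((h3.mul_const Complex.I).neg)
      simpa [Function.comp_def] using h4
    have hlim := hM.mul hE
    have e : Complex.exp ((τ * Complex.I) ^ 2 / 2) * 1 = charFun (gaussianReal 0 1) τ := by
      rw [charFun_gaussianReal, mul_one]
      congr 1
      rw [mul_pow, Complex.I_sq]
      push_cast
      ring
    rw [e] at hlim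
    refine hlim.congr' ?_
    filter_upwards [hσpos] with n hσ
    exact (charFun_map_blockLaw r m s n _ _ _ _ τ (Real.sqrt_pos.2 hσ.1).ne').symm
  have hν : Tendsto ν atTop (𝓝 γ) :=
    ProbabilityMeasure.tendsto_of_tendsto_charFun fun τ =>
      (hchar τ).comp (tendsto_add_atTop_nat s)
  -- The Gaussian law has no atoms, so weak convergence yields convergence of the distribution
  -- function at every `t`.
  have hnull : γ (frontier (Set.Iic t)) = 0 := by
    have := nullSingletonClass_gaussianReal (μ := 0) (v := 1) one_ne_zero
    rw [frontier_Iic, ProbabilityMeasure.coeFn_def]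
    simp [γ]
  have hcdf := ProbabilityMeasure.tendsto_measure_of_null_frontier_of_tendsto hν hnull
  rw [← tendsto_add_atTop_iff_nat s]
  have hcdf' := (NNReal.continuous_coe.tendsto _).comp hcdf
  refine hcdf'.congr fun n => ?_
  change ((blockLaw r m s (n + s)).map (g (n + s))).real (Set.Iic t) = _
  rw [map_measureReal_apply (hg _) measurableSet_Iic]
  rfl

theorem mainTheorem2 (r m s : ℕ) (hm : 1 ≤ m) (hs : 1 ≤ s) :
    (∀ x z : ℂ, HasSum
      (fun n : ℕ => (∑ k ∈ Finset.range (n + 1), (assocWhitney r m s n k : ℂ) * x ^ k)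
        * z ^ n / (n.factorial : ℂ))
      (Complex.exp ((r : ℂ) * z + x / (m : ℂ) * (Complex.exp ((m : ℂ) * z)
        - ∑ j ∈ Finset.range s, ((m : ℂ) * z) ^ j / (j.factorial : ℂ))))) ∧
    (∀ n : ℕ, s ≤ n → IsProbabilityMeasure (blockLaw r m s n)) ∧
    (fun n : ℕ => blockMean r m s n) ~[atTop] (fun n : ℕ => (n : ℝ) / Real.log n) ∧
    (fun n : ℕ => blockVariance r m s n) ~[atTop] (fun n : ℕ => (n : ℝ) / Real.log n ^ 2) ∧
    (∀ t : ℝ, Tendsto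
      (fun n : ℕ => (blockLaw r m s n).real
        {x : ℝ | (x - blockMean r m s n) / Real.sqrt (blockVariance r m s n) ≤ t})
      atTop (𝓝 ((gaussianReal 0 1).real (Set.Iic t)))) := by
  have hm0 : (0 : ℝ) < m := by exact_mod_cast hm
  obtain ⟨y, hn, hy⟩ := exists_saddlePoint (κ := 1 / m) (ρ := r / m) (by positivity)
    (by positivity) s
  exact ⟨hasSum_whitneyGF r hm hs,
    fun n hns => isProbabilityMeasure_blockLaw (assocDowling_pos r hm hs hns),
    blockMean_isEquivalent r hm hs hn hy, blockVariance_isEquivalent r hm hs hn hy,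
    tendsto_blockLaw_real_Iic r hm hs hn hy⟩
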